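/- Let $d\ge 1$, $\alpha\in[-1/2,\infty)^d$, $\varepsilon\in\{0,1\}^d$ and $\gamma\in\mathbb{R}\setminus\{0\}$. Let $\mathbb{R}^d_+=(0,\infty)^d$, let $w_\alpha^+$ be the measure on $\mathbb{R}^d_+$ with density $\prod_{i=1}^d x_i^{2\alpha_i+1}$ with respect to Lebesgue measure, and let $B^+(x,r)=\{z\in\mathbb{R}^d_+:\|z-x\|<r\}$, where $\|\cdot\|$ is the Euclidean norm. For $t>0$ and $x,y\in\mathbb{R}^d_+$ put $$G_t^{\alpha,\varepsilon}(x,y)=\frac{1}{(2\sinh 2t)^d}\exp\Big(-\tfrac12\coth(2t)\big(\|x\|^2+\|y\|^2\big)\Big)\prod_{i=1}^d (x_iy_i)^{\varepsilon_i}\,\frac{I_{\alpha_i+\varepsilon_i}\big(\frac{x_iy_i}{\sinh 2t}\big)}{(x_iy_i)^{\alpha_i+\varepsilon_i}},$$ where $I_\nu(z)=\sum_{k=0}^\infty \frac{(z/2)^{\nu+2k}}{\Gamma(k+1)\Gamma(k+\nu+1)}$ is the modified Bessel function of the first kind, and let $$K_\gamma^{\alpha,\varepsilon}(x,y)=\frac{1}{\Gamma(i\gamma)}\int_0^\infty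 G_t^{\alpha,\varepsilon}(x,y)\,t^{i\gamma-1}\,dt .$$ Then for all $x,y\in\mathbb{R}^d_+$ with $x\ne y$ this integral converges absolutely, $K_\gamma^{\alpha,\varepsilon}$ is (real-)differentiable at $(x,y)$, and there is a constant $C>0$, independent of $x$ and $y$, such that for all $x,y\in\mathbb{R}^d_+$ with $x\neq y$ $$|K_\gamma^{\alpha,\varepsilon}(x,y)|\le \frac{C}{w_\alpha^+\big(B^+(x,\|y-x\|)\big)}$$ and $$\|\nabla_{x,y}K_\gamma^{\alpha,\varepsilon}(x,y)\|\le \frac{C}{\|x-y\|\,w_\alpha^+\big(B^+(x,\|y-x\|)\big)},$$ where $\nabla_{x,y}K$ is the vector of all $2d$ partial derivatives of $K$ in $x_1,\dots,x_d,y_1,\dots,y_d$. -/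

import Mathlib

namespace DunklHermite

noncomputable section

/-- The modified Bessel function of the first kind `I_ν(z)`, used for `z > 0` and `ν ≥ -1/2`. -/
def besselI (ν z : ℝ) : ℝ :=
  ∑' k : ℕ, (z / 2) ^ (ν + 2 * (k : ℝ)) /
    (Real.Gamma ((k : ℝ) + 1) * Real.Gamma ((k : ℝ) + ν + 1))

/-- The open orthant `ℝ^d_+ = (0, ∞)^d`. -/
def orthant (d : ℕ) : Set (EuclideanSpace ℝ (Fin d)) :=
  {x | ∀ i, 0 < x i}

/-- The weight `w_α(x) = ∏ |x_i|^(2 α_i + 1)`. -/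
def weight {d : ℕ} (α : Fin d → ℝ) (x : EuclideanSpace ℝ (Fin d)) : ℝ :=
  ∏ i, |x i| ^ (2 * α i + 1)

/-- The measure `w_α^+` on `ℝ^d_+`: density `w_α` with respect to Lebesgue measure on the orthant. -/
def weightMeasure {d : ℕ} (α : Fin d → ℝ) :
    MeasureTheory.Measure (EuclideanSpace ℝ (Fin d)) :=
  (MeasureTheory.volume.restrict (orthant d)).withDensity
    (fun x => ENNReal.ofReal (weight α x))

/-- `B^+(x, r) = B(x, r) ∩ ℝ^d_+`. -/
def orthantBall {d : ℕ} (x : EuclideanSpace ℝ (Fin d)) (r : ℝ) :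
    Set (EuclideanSpace ℝ (Fin d)) :=
  Metric.ball x r ∩ orthant d

/-- The component `G_t^{α,ε}(x, y)` of the heat kernel of the Dunkl harmonic oscillator,
for `t > 0` and `x, y` in the orthant; here `coth = cosh / sinh`. -/
def heatKernel {d : ℕ} (α : Fin d → ℝ) (ε : Fin d → Fin 2) (t : ℝ)
    (x y : EuclideanSpace ℝ (Fin d)) : ℝ :=
  1 / (2 * Real.sinh (2 * t)) ^ d *
    Real.exp (-(1 / 2) * (Real.cosh (2 * t) / Real.sinh (2 * t)) * (‖x‖ ^ 2 + ‖y‖ ^ 2)) *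
    ∏ i, ((x i * y i) ^ (ε i).val *
      (besselI (α i + ((ε i).val : ℝ)) (x i * y i / Real.sinh (2 * t)) /
        (x i * y i) ^ (α i + ((ε i).val : ℝ))))

/-- The integrand `G_t^{α,ε}(x, y) t^(iγ - 1)`. -/
def kernelIntegrand {d : ℕ} (α : Fin d → ℝ) (ε : Fin d → Fin 2) (γ : ℝ)
    (x y : EuclideanSpace ℝ (Fin d)) (t : ℝ) : ℂ :=
  (heatKernel α ε t x y : ℂ) * (t : ℂ) ^ (Complex.I * (γ : ℂ) - 1)

/-- The kernel `K_γ^{α,ε}(x, y) = Γ(iγ)⁻¹ ∫_0^∞ G_t^{α,ε}(x, y) t^(iγ - 1) dt`. -/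
def kernel {d : ℕ} (α : Fin d → ℝ) (ε : Fin d → Fin 2) (γ : ℝ)
    (x y : EuclideanSpace ℝ (Fin d)) : ℂ :=
  1 / Complex.Gamma (Complex.I * (γ : ℂ)) *
    ∫ t in Set.Ioi (0 : ℝ), kernelIntegrand α ε γ x y t

/-- `‖∇_{x,y} F(x, y)‖`: the Euclidean norm in `ℂ^{2d}` of the vector of all partial derivatives
`∂F/∂x_i`, `∂F/∂y_i`, meaningful where `F` is differentiable. -/
def gradNorm {d : ℕ} (F : EuclideanSpace ℝ (Fin d) → EuclideanSpace ℝ (Fin d) → ℂ)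
    (x y : EuclideanSpace ℝ (Fin d)) : ℝ :=
  Real.sqrt
    (∑ i, ‖fderiv ℝ (Function.uncurry F) (x, y) (EuclideanSpace.single i 1, 0)‖ ^ 2 +
     ∑ i, ‖fderiv ℝ (Function.uncurry F) (x, y) (0, EuclideanSpace.single i 1)‖ ^ 2)

end

end DunklHermite

/-!
Write `E_ν(z) = z ^ (-ν) I_ν(z)`. The relations `E_ν' = z E_{ν+1}` and
`E_ν = (2ν + 2) E_{ν+1} + z² E_{ν+2}` show that for suitable `p ≥ 0` the differences
`D = E_ν - (z + ν + 1/2) E_{ν+1}` and `D = (z + 2ν + 2) E_{ν+1} - E_ν` satisfy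
`z D' + (z + p) D ≥ 0`. Then `z ^ p e ^ z D` is increasing, so `D ≥ 0`, and these two bounds on
`E_{ν+1} / E_ν` control `e ^ (-z) E_ν(z)` by `(1 + z) ^ (-ν - 1/2)` and give a similar bound for its
derivative.

Put `s = sinh 2t`, `r = ‖x - y‖` and `W = ∏ (x_i + r) ^ (2 α_i + 1)`. Since
`(x_i + r)² ≤ 4 (1 + r² / s) (s + x_i y_i)` and the Gaussian factor of `G_t` absorbs every power of
`1 + r² / s`, one gets `|G_t| ≤ C W⁻¹ s (s + r²) ^ (-d/2 - 1)` and the same bound with a further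
`r⁻¹` for the gradient. As `|t ^ (iγ - 1)| = t⁻¹` and `sinh 2t ≤ 2t cosh 2t`, the integrand is
dominated by a multiple of the derivative of `-(s + r²) ^ (-d/2)`, which integrates to `r ^ (-d)`.
Finally, the ball `B⁺(x, r)` has measure at most a constant times `r ^ d W`.
-/

namespace DunklHermite

noncomputable section

open Real MeasureTheory Set

/-! ### Modified Bessel functions -/

/-- The Bessel–Clifford function `∑ u ^ k / (k! Γ(k + ν + 1))`. It is entire in `u` for every real
`ν`: at the poles of `Γ` the conventions `Γ = 0` and `1 / 0 = 0` give the value `0` of `1 / Γ`. -/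
def besselClifford (ν u : ℝ) : ℝ :=
  ∑' k : ℕ, u ^ k / (k.factorial * Gamma (k + ν + 1))

/-- The reduced modified Bessel function `z ^ (-ν) * I_ν(z)`, extended to an entire function of
`z`. -/
def reducedBesselI (ν z : ℝ) : ℝ := 2 ^ (-ν) * besselClifford ν (z ^ 2 / 4)

lemma inv_Gamma_eq_mul_inv_Gamma_add_one (s : ℝ) : (Gamma s)⁻¹ = s * (Gamma (s + 1))⁻¹ := by
  rcases eq_or_ne s 0 with rfl | hs
  · simp
  · rw [Gamma_add_one hs, mul_inv, mul_inv_cancel_left₀ hs]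

lemma one_le_Gamma {s : ℝ} (hs : 2 ≤ s) : 1 ≤ Gamma s :=
  Gamma_two ▸ Gamma_strictMonoOn_Ici.monotoneOn self_mem_Ici hs hs

lemma summable_besselClifford (ν u : ℝ) :
    Summable fun k : ℕ => u ^ k / (k.factorial * Gamma (k + ν + 1)) := by
  refine Summable.of_norm_bounded_eventually_nat (summable_pow_div_factorial |u|) ?_
  filter_upwards [Filter.eventually_ge_atTop ⌈1 - ν⌉₊] with k hk
  have hΓ : 1 ≤ Gamma (k + ν + 1) := one_le_Gamma (by linarith [Nat.ceil_le.mp hk])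
  rw [norm_div, norm_pow, norm_mul, norm_natCast, norm_eq_abs, norm_of_nonneg (by linarith)]
  gcongr
  exact le_mul_of_one_le_right (by positivity) hΓ

lemma succ_mul_besselClifford_coeff (ν : ℝ) (k : ℕ) :
    (k + 1 : ℝ) / ((k + 1).factorial * Gamma ((k + 1 : ℕ) + ν + 1)) =
      1 / (k.factorial * Gamma (k + (ν + 1) + 1)) := by
  have hk : (k : ℝ) + 1 ≠ 0 := by positivity
  rw [Nat.factorial_succ, Nat.cast_mul, Nat.cast_succ, mul_assoc, ← div_div, div_self hk,
    add_right_comm (k : ℝ) 1 ν, add_assoc (k : ℝ) ν 1]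

lemma summable_deriv_besselClifford (ν u : ℝ) :
    Summable fun k : ℕ => k * u ^ (k - 1) / (k.factorial * Gamma (k + ν + 1)) := by
  rw [← summable_nat_add_iff 1]
  refine (summable_besselClifford (ν + 1) u).congr fun k => ?_
  rw [div_eq_mul_one_div, ← succ_mul_besselClifford_coeff, Nat.add_sub_cancel]
  push_cast
  ring

lemma tsum_deriv_besselClifford (ν u : ℝ) :
    ∑' k : ℕ, k * u ^ (k - 1) / (k.factorial * Gamma (k + ν + 1)) = besselClifford (ν + 1) u := by
  rw [(summable_deriv_besselClifford ν u).tsum_eq_zero_add, besselClifford, Nat.cast_zero,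
    zero_mul, zero_div, zero_add]
  refine tsum_congr fun k => ?_
  rw [div_eq_mul_one_div (u ^ k), ← succ_mul_besselClifford_coeff, Nat.add_sub_cancel]
  push_cast
  ring

lemma hasDerivAt_besselClifford (ν u : ℝ) :
    HasDerivAt (besselClifford ν) (besselClifford (ν + 1) u) u := by
  have hu : u ∈ Metric.ball (0 : ℝ) (|u| + 1) := by simp
  refine (hasDerivAt_tsum_of_isPreconnected (summable_deriv_besselClifford ν (|u| + 1)).norm
    Metric.isOpen_ball (convex_ball 0 (|u| + 1)).isPreconnected
    (fun k v _ => (hasDerivAt_pow k v).div_const _) (fun k v hv => ?_) hu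
    (summable_besselClifford ν u) hu).congr_deriv (tsum_deriv_besselClifford ν u)
  have hv' : ‖v‖ ≤ ‖|u| + 1‖ := (mem_ball_zero_iff.mp hv).le.trans (le_abs_self _)
  simp only [norm_div, norm_mul, norm_pow]
  gcongr

lemma besselClifford_recurrence (ν u : ℝ) :
    besselClifford ν u =
      (ν + 1) * besselClifford (ν + 1) u + u * besselClifford (ν + 2) u := by
  have hsum := (summable_deriv_besselClifford (ν + 1) u).mul_left u
  rw [show ν + 2 = ν + 1 + 1 by ring, ← tsum_deriv_besselClifford (ν + 1), ← tsum_mul_left,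
    besselClifford, besselClifford, ← tsum_mul_left,
    ← ((summable_besselClifford (ν + 1) u).mul_left _).tsum_add hsum]
  refine tsum_congr fun k => ?_
  have hpow : u * (k * u ^ (k - 1)) = k * u ^ k := by
    rcases k with _ | k
    · simp
    · rw [Nat.add_sub_cancel, pow_succ]; ring
  simp only [div_eq_mul_inv, mul_inv]
  rw [inv_Gamma_eq_mul_inv_Gamma_add_one (k + ν + 1), add_assoc (k : ℝ) ν 1]
  linear_combination (-(k.factorial : ℝ)⁻¹ * (Gamma (k + (ν + 1) + 1))⁻¹) * hpow

lemma besselClifford_pos {ν u : ℝ} (hν : -1 < ν) (hu : 0 ≤ u) : 0 < besselClifford ν u := by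
  have hΓ (k : ℕ) : 0 < Gamma (k + ν + 1) :=
    Gamma_pos_of_pos (by linarith [k.cast_nonneg (α := ℝ)])
  refine (summable_besselClifford ν u).tsum_pos (fun k => ?_) 0 ?_
  · have := hΓ k
    positivity
  · have := hΓ 0
    positivity

lemma reducedBesselI_pos {ν : ℝ} (hν : -1 < ν) (z : ℝ) : 0 < reducedBesselI ν z :=
  mul_pos (by positivity) (besselClifford_pos hν (by positivity))

lemma two_rpow_neg_add_one (ν : ℝ) : (2 : ℝ) ^ (-(ν + 1)) = 2 ^ (-ν) / 2 := by
  rw [neg_add', rpow_sub_one two_ne_zero]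

lemma hasDerivAt_reducedBesselI (ν z : ℝ) :
    HasDerivAt (reducedBesselI ν) (z * reducedBesselI (ν + 1) z) z := by
  refine (((hasDerivAt_besselClifford ν (z ^ 2 / 4)).comp z
    ((hasDerivAt_pow 2 z).div_const 4)).const_mul (2 ^ (-ν))).congr_deriv ?_
  rw [reducedBesselI, two_rpow_neg_add_one]
  norm_num
  ring

lemma reducedBesselI_recurrence (ν z : ℝ) :
    reducedBesselI ν z =
      (2 * ν + 2) * reducedBesselI (ν + 1) z + z ^ 2 * reducedBesselI (ν + 2) z := by
  simp only [reducedBesselI]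
  rw [besselClifford_recurrence, show ν + 2 = ν + 1 + 1 by ring, two_rpow_neg_add_one (ν + 1),
    two_rpow_neg_add_one ν]
  ring

lemma besselI_eq_rpow_mul_reducedBesselI (ν : ℝ) {z : ℝ} (hz : 0 < z) :
    besselI ν z = z ^ ν * reducedBesselI ν z := by
  rw [besselI, reducedBesselI, besselClifford, ← tsum_mul_left, ← tsum_mul_left]
  refine tsum_congr fun k => ?_
  have hpow : (z / 2) ^ (ν + 2 * (k : ℝ)) = z ^ ν * 2 ^ (-ν) * (z ^ 2 / 4) ^ k := by
    rw [rpow_add (by positivity), div_rpow hz.le two_pos.le, rpow_neg two_pos.le,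
      rpow_mul (by positivity), rpow_natCast, rpow_two, div_pow, ← div_eq_mul_inv]
    norm_num
  rw [hpow, Gamma_nat_eq_factorial]
  ring

lemma monotoneOn_rpow_mul_exp_mul {D D' : ℝ → ℝ} {p : ℝ} (hp : 0 ≤ p)
    (hD : ∀ z, HasDerivAt D (D' z) z) (h : ∀ z, 0 < z → 0 ≤ z * D' z + (z + p) * D z) :
    MonotoneOn (fun z => z ^ p * exp z * D z) (Ici 0) := by
  have hcont : Continuous D := continuous_iff_continuousAt.mpr fun z => (hD z).continuousAt
  refine monotoneOn_of_hasDerivWithinAt_nonneg (convex_Ici 0)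
    (f' := fun z => z ^ (p - 1) * exp z * (z * D' z + (z + p) * D z))
    (((continuous_rpow_const hp).mul continuous_exp).mul hcont).continuousOn
    (fun w hw => ?_) (fun w hw => ?_) <;> rw [interior_Ici, mem_Ioi] at hw
  · refine (((hasDerivAt_rpow_const (p := p) (Or.inl hw.ne')).mul
      (hasDerivAt_exp w)).mul (hD w)).hasDerivWithinAt.congr_deriv ?_
    simp only [Pi.mul_apply]
    rw [rpow_sub_one hw.ne']
    field_simp
    ring
  · have := h w hw
    positivity

lemma nonneg_of_mul_deriv_add_nonneg {D D' : ℝ → ℝ} {p : ℝ} (hp : 0 ≤ p)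
    (hD : ∀ z, HasDerivAt D (D' z) z) (h0 : 0 ≤ D 0)
    (h : ∀ z, 0 < z → 0 ≤ z * D' z + (z + p) * D z) {z : ℝ} (hz : 0 ≤ z) : 0 ≤ D z := by
  rcases hz.eq_or_lt with rfl | hz0
  · exact h0
  have hmono : 0 ^ p * exp 0 * D 0 ≤ z ^ p * exp z * D z :=
    monotoneOn_rpow_mul_exp_mul hp hD h self_mem_Ici hz hz
  exact nonneg_of_mul_nonneg_right (le_trans (by positivity) hmono) (by positivity)

lemma hasDerivAt_add_const_mul_reducedBesselI (ν κ z : ℝ) :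
    HasDerivAt (fun w => (w + κ) * reducedBesselI (ν + 1) w)
      (reducedBesselI (ν + 1) z + (z + κ) * (z * reducedBesselI (ν + 2) z)) z := by
  have h := ((hasDerivAt_id z).add_const κ).mul (hasDerivAt_reducedBesselI (ν + 1) z)
  rwa [one_mul, show ν + 1 + 1 = ν + 2 by ring] at h

lemma mul_reducedBesselI_add_one_le {ν z : ℝ} (hν : -(1 / 2) ≤ ν) (hz : 0 ≤ z) :
    (z + (ν + 1 / 2)) * reducedBesselI (ν + 1) z ≤ reducedBesselI ν z := by
  have hpos (w : ℝ) : 0 < reducedBesselI (ν + 1) w := reducedBesselI_pos (by linarith) w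
  rw [← sub_nonneg]
  refine nonneg_of_mul_deriv_add_nonneg (p := ν + 1 / 2) (by linarith)
    (fun w => (hasDerivAt_reducedBesselI ν w).sub
      (hasDerivAt_add_const_mul_reducedBesselI ν (ν + 1 / 2) w)) ?_ (fun w _ => ?_) hz
  · rw [Pi.sub_apply, reducedBesselI_recurrence]
    nlinarith [hpos 0]
  · calc 0 ≤ (ν + 1 / 2) * (ν + 3 / 2) * reducedBesselI (ν + 1) w :=
          mul_nonneg (mul_nonneg (by linarith) (by linarith)) (hpos w).le
      _ = _ := by rw [Pi.sub_apply, reducedBesselI_recurrence ν w]; ring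

lemma reducedBesselI_le_mul_add_one {ν z : ℝ} (hν : -1 < ν) (hz : 0 ≤ z) :
    reducedBesselI ν z ≤ (z + (2 * ν + 2)) * reducedBesselI (ν + 1) z := by
  have hpos (w : ℝ) : 0 < reducedBesselI (ν + 1) w := reducedBesselI_pos (by linarith) w
  rw [← sub_nonneg]
  refine nonneg_of_mul_deriv_add_nonneg (p := 2 * ν + 2) (by linarith)
    (fun w => (hasDerivAt_add_const_mul_reducedBesselI ν (2 * ν + 2) w).sub
      (hasDerivAt_reducedBesselI ν w)) ?_ (fun w hw => ?_) hz
  · simp [reducedBesselI_recurrence ν 0]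
  · calc 0 ≤ (2 * ν + 3) * w * reducedBesselI (ν + 1) w :=
          mul_nonneg (mul_nonneg (by linarith) hw.le) (hpos w).le
      _ = _ := by rw [Pi.sub_apply, reducedBesselI_recurrence ν w]; ring

lemma antitoneOn_rpow_mul_exp_neg_mul_reducedBesselI {ν : ℝ} (hν : -(1 / 2) ≤ ν) :
    AntitoneOn (fun z => (z + (ν + 3 / 2)) ^ (ν + 1 / 2) * (exp (-z) * reducedBesselI ν z))
      (Ici 0) := by
  have hder (w : ℝ) (hw : 0 ≤ w) :
      HasDerivAt (fun z => (z + (ν + 3 / 2)) ^ (ν + 1 / 2) * (exp (-z) * reducedBesselI ν z))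
        ((w + (ν + 3 / 2)) ^ (ν + 1 / 2 - 1) * exp (-w) *
          ((w + (ν + 3 / 2)) * w * reducedBesselI (ν + 1) w - (w + 1) * reducedBesselI ν w)) w := by
    have hb : 0 < w + (ν + 3 / 2) := by linarith
    refine ((((hasDerivAt_id w).add_const (ν + 3 / 2)).rpow_const (Or.inl hb.ne')).mul
      ((hasDerivAt_neg w).exp.mul (hasDerivAt_reducedBesselI ν w))).congr_deriv ?_
    simp only [Pi.mul_apply, id]
    rw [← sub_add_cancel (ν + 1 / 2) 1, rpow_add_one hb.ne', sub_add_cancel]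
    ring
  refine antitoneOn_of_hasDerivWithinAt_nonpos (convex_Ici 0)
    (fun w hw => (hder w hw).continuousAt.continuousWithinAt)
    (fun w hw => (hder w (interior_subset hw)).hasDerivWithinAt) fun w hw => ?_
  have hw0 : 0 ≤ w := interior_subset hw
  have hE := reducedBesselI_pos (ν := ν + 1) (by linarith) w
  have hb : 0 ≤ w + (ν + 3 / 2) := by linarith
  have hratio := mul_le_mul_of_nonneg_left (mul_reducedBesselI_add_one_le hν hw0)
    (by linarith : 0 ≤ w + 1)
  refine mul_nonpos_of_nonneg_of_nonpos (by positivity) ?_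
  nlinarith

lemma exists_exp_neg_mul_reducedBesselI_le {ν : ℝ} (hν : -(1 / 2) ≤ ν) :
    ∃ C : ℝ, 0 < C ∧ ∀ z, 0 ≤ z →
      exp (-z) * reducedBesselI ν z ≤ C * (1 + z) ^ (-(ν + 1 / 2)) := by
  have hpos (z : ℝ) : 0 < reducedBesselI ν z := reducedBesselI_pos (by linarith) z
  refine ⟨(ν + 3 / 2) ^ (ν + 1 / 2) * reducedBesselI ν 0,
    mul_pos (rpow_pos_of_pos (by linarith) _) (hpos 0), fun z hz => ?_⟩
  rw [rpow_neg (by positivity), ← div_eq_mul_inv, le_div_iff₀ (by positivity), mul_comm]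
  have hz' := hpos z
  calc (1 + z) ^ (ν + 1 / 2) * (exp (-z) * reducedBesselI ν z)
      ≤ (z + (ν + 3 / 2)) ^ (ν + 1 / 2) * (exp (-z) * reducedBesselI ν z) := by
        gcongr ?_ ^ _ * _ <;> linarith
    _ ≤ _ := by
        simpa using antitoneOn_rpow_mul_exp_neg_mul_reducedBesselI hν self_mem_Ici hz hz

/-- The function `e ^ (-z) z ^ (-α) I_{α + e}(z)`, extended smoothly across `z = 0`. -/
def scaledBessel (α : ℝ) (e : ℕ) (z : ℝ) : ℝ := exp (-z) * (z ^ e * reducedBesselI (α + e) z)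

lemma hasDerivAt_scaledBessel (α : ℝ) (e : ℕ) (z : ℝ) :
    HasDerivAt (scaledBessel α e)
      (exp (-z) * (e * z ^ (e - 1) * reducedBesselI (α + e) z -
        z ^ e * (reducedBesselI (α + e) z - z * reducedBesselI (α + e + 1) z))) z := by
  refine ((hasDerivAt_neg z).exp.mul
    ((hasDerivAt_pow e z).mul (hasDerivAt_reducedBesselI (α + e) z))).congr_deriv ?_
  simp only [Pi.mul_apply]
  ring

lemma continuous_scaledBessel (α : ℝ) (e : ℕ) : Continuous (scaledBessel α e) :=
  continuous_iff_continuousAt.mpr fun z => (hasDerivAt_scaledBessel α e z).continuousAt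

lemma exists_exp_neg_mul_one_add_pow_mul_reducedBesselI_le {a : ℝ} (m : ℕ)
    (ha : -(1 / 2) ≤ a + m) :
    ∃ C : ℝ, 0 < C ∧ ∀ z, 0 ≤ z →
      exp (-z) * ((1 + z) ^ m * reducedBesselI (a + m) z) ≤ C * (1 + z) ^ (-(a + 1 / 2)) := by
  obtain ⟨C, hC, hb⟩ := exists_exp_neg_mul_reducedBesselI_le ha
  refine ⟨C, hC, fun z hz => ?_⟩
  calc exp (-z) * ((1 + z) ^ m * reducedBesselI (a + m) z)
      = (1 + z) ^ m * (exp (-z) * reducedBesselI (a + m) z) := by ring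
    _ ≤ (1 + z) ^ m * (C * (1 + z) ^ (-(a + m + 1 / 2))) := by gcongr ?_ * ?_; exact hb z hz
    _ = C * ((1 + z) ^ (m : ℝ) * (1 + z) ^ (-(a + m + 1 / 2))) := by rw [rpow_natCast]; ring
    _ = C * (1 + z) ^ (-(a + 1 / 2)) := by rw [← rpow_add (by positivity)]; ring_nf

lemma exists_abs_scaledBessel_le {α : ℝ} {e : ℕ} (h : -(1 / 2) ≤ α + e) :
    ∃ C : ℝ, 0 < C ∧ ∀ z, 0 ≤ z → |scaledBessel α e z| ≤ C * (1 + z) ^ (-(α + 1 / 2)) := by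
  obtain ⟨C, hC, hb⟩ := exists_exp_neg_mul_one_add_pow_mul_reducedBesselI_le e h
  refine ⟨C, hC, fun z hz => ?_⟩
  have hE : 0 < reducedBesselI (α + e) z := reducedBesselI_pos (by linarith) z
  rw [scaledBessel, abs_of_nonneg (by positivity)]
  refine le_trans ?_ (hb z hz)
  gcongr
  linarith

lemma natCast_mul_pow_pred_mul_one_add_le {z : ℝ} (hz : 0 ≤ z) (e : ℕ) :
    e * z ^ (e - 1) * (1 + z) ≤ e * (1 + z) ^ e := by
  rcases e with _ | n
  · simp
  · rw [Nat.add_sub_cancel, pow_succ, mul_assoc]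
    gcongr
    linarith

lemma exists_abs_deriv_scaledBessel_mul_le {α : ℝ} {e : ℕ} (h : -(1 / 2) ≤ α + e) :
    ∃ C : ℝ, 0 < C ∧ ∀ z, 0 ≤ z →
      |deriv (scaledBessel α e) z| * (1 + z) ≤ C * (1 + z) ^ (-(α + 1 / 2)) := by
  obtain ⟨C₀, hC₀, h₀⟩ := exists_exp_neg_mul_one_add_pow_mul_reducedBesselI_le e h
  obtain ⟨C₁, hC₁, h₁⟩ := exists_exp_neg_mul_one_add_pow_mul_reducedBesselI_le (a := α) (e + 1)
    (by push_cast; linarith)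
  have hm : 0 < 2 * (α + e) + 2 := by linarith
  refine ⟨e * C₀ + (2 * (α + e) + 2) * C₁, by positivity, fun z hz => ?_⟩
  specialize h₀ z hz
  specialize h₁ z hz
  rw [Nat.cast_succ, ← add_assoc] at h₁
  rw [(hasDerivAt_scaledBessel α e z).deriv]
  set E := reducedBesselI (α + e) z
  set E₁ := reducedBesselI (α + e + 1) z
  have hE : 0 < E := reducedBesselI_pos (by linarith) z
  have hE₁ : 0 < E₁ := reducedBesselI_pos (by linarith) z
  have hlow : 0 ≤ E - z * E₁ := by
    nlinarith [mul_reducedBesselI_add_one_le h hz]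
  have hup : E - z * E₁ ≤ (2 * (α + e) + 2) * E₁ := by
    linarith [reducedBesselI_le_mul_add_one (by linarith : -1 < α + e) hz]
  have hzle : z ≤ 1 + z := by linarith
  rw [abs_mul, abs_of_pos (exp_pos _)]
  calc exp (-z) * |e * z ^ (e - 1) * E - z ^ e * (E - z * E₁)| * (1 + z)
      ≤ exp (-z) * (e * z ^ (e - 1) * E + z ^ e * (E - z * E₁)) * (1 + z) := by
        gcongr
        rw [abs_le]
        constructor <;> linarith [show 0 ≤ e * z ^ (e - 1) * E by positivity,
          show 0 ≤ z ^ e * (E - z * E₁) by positivity]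
    _ = exp (-z) * (e * z ^ (e - 1) * (1 + z) * E + z ^ e * (E - z * E₁) * (1 + z)) := by ring
    _ ≤ exp (-z) * (e * (1 + z) ^ e * E +
          (1 + z) ^ e * ((2 * (α + e) + 2) * E₁) * (1 + z)) := by
        gcongr ?_ * (?_ * ?_ + ?_ ^ _ * ?_ * ?_)
        exact natCast_mul_pow_pred_mul_one_add_le hz e
    _ = e * (exp (-z) * ((1 + z) ^ e * E)) +
          (2 * (α + e) + 2) * (exp (-z) * ((1 + z) ^ (e + 1) * E₁)) := by ring
    _ ≤ e * (C₀ * (1 + z) ^ (-(α + 1 / 2))) +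
          (2 * (α + e) + 2) * (C₁ * (1 + z) ^ (-(α + 1 / 2))) := by gcongr
    _ = _ := by ring

/-! ### The one-dimensional factor of the heat kernel -/

/-- The exponential factor of the one-dimensional heat kernel that remains when `e ^ (x y / s)` is
moved into the Bessel function; `s = sinh 2t` and `c = cosh 2t`. -/
def heatGaussian (s c x y : ℝ) : ℝ :=
  exp (-((x - y) ^ 2 / (2 * s)) - (c - 1) / (2 * s) * (x ^ 2 + y ^ 2))

/-- The one-dimensional factor of the heat kernel, with `s = sinh 2t` and `c = cosh 2t`. -/
def heatFactor (α : ℝ) (e : ℕ) (s c x y : ℝ) : ℝ :=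
  1 / 2 * s ^ (-(1 + α)) * (heatGaussian s c x y * scaledBessel α e (x * y / s))

/-- The partial derivative of `heatFactor` in `x`; by symmetry, `heatFactorDeriv α e s c y x` is
that in `y`. -/
def heatFactorDeriv (α : ℝ) (e : ℕ) (s c x y : ℝ) : ℝ :=
  1 / 2 * s ^ (-(1 + α)) * (heatGaussian s c x y *
    (y / s * deriv (scaledBessel α e) (x * y / s) -
      ((x - y) / s + (c - 1) / s * x) * scaledBessel α e (x * y / s)))

lemma heatGaussian_comm (s c x y : ℝ) : heatGaussian s c x y = heatGaussian s c y x := by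
  rw [heatGaussian, heatGaussian, ← neg_sub y x, neg_sq, add_comm (x ^ 2)]

lemma heatGaussian_pos (s c x y : ℝ) : 0 < heatGaussian s c x y := exp_pos _

lemma exp_coth_eq_heatGaussian_mul {s : ℝ} (hs : s ≠ 0) (c x y : ℝ) :
    exp (-(1 / 2) * (c / s) * (x ^ 2 + y ^ 2)) =
      heatGaussian s c x y * exp (-(x * y / s)) := by
  rw [heatGaussian, ← exp_add]
  congr 1
  field_simp
  ring

section Derivatives

variable {E : Type*} [NormedAddCommGroup E] [NormedSpace ℝ E] {X Y : E → ℝ} {X' Y' : E →L[ℝ] ℝ}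
  {p : E}

lemma hasFDerivAt_heatGaussian (s c : ℝ) (hX : HasFDerivAt X X' p) (hY : HasFDerivAt Y Y' p) :
    HasFDerivAt (fun q => heatGaussian s c (X q) (Y q))
      (-heatGaussian s c (X p) (Y p) • (((X p - Y p) / s + (c - 1) / s * X p) • X' +
        ((Y p - X p) / s + (c - 1) / s * Y p) • Y')) p := by
  refine (((((hX.sub hY).pow 2).mul_const (2 * s)⁻¹).neg).sub
    (((hX.pow 2).add (hY.pow 2)).const_mul ((c - 1) / (2 * s)))).exp.congr_fderiv ?_
  ext v
  simp only [add_apply, sub_apply, neg_apply, Pi.add_apply, Pi.sub_apply, Pi.neg_apply,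
    smul_apply, smul_eq_mul, nsmul_eq_mul, heatGaussian, div_eq_mul_inv, mul_inv]
  push_cast
  ring

lemma hasFDerivAt_heatFactor (α : ℝ) (e : ℕ) (s c : ℝ) (hX : HasFDerivAt X X' p)
    (hY : HasFDerivAt Y Y' p) :
    HasFDerivAt (fun q => heatFactor α e s c (X q) (Y q))
      (heatFactorDeriv α e s c (X p) (Y p) • X' + heatFactorDeriv α e s c (Y p) (X p) • Y') p := by
  have hz : HasFDerivAt (fun q => X q * Y q / s) (s⁻¹ • (X p • Y' + Y p • X')) p := by
    simpa [div_eq_mul_inv] using (hX.mul hY).mul_const s⁻¹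
  have hbessel := (hasDerivAt_scaledBessel α e (X p * Y p / s)).differentiableAt.hasDerivAt
    |>.comp_hasFDerivAt p hz
  refine (((hasFDerivAt_heatGaussian s c hX hY).mul hbessel).const_mul
    (1 / 2 * s ^ (-(1 + α)))).congr_fderiv ?_
  ext v
  simp only [Function.comp_apply, add_apply, smul_apply, smul_eq_mul, heatFactorDeriv,
    heatGaussian_comm s c (Y p) (X p), mul_comm (Y p) (X p)]
  ring

end Derivatives

/-- The Gaussian majorant of `heatFactor`. -/
def heatFactorBound (α s c x y : ℝ) : ℝ :=
  s ^ (-(1 + α)) * (1 + x * y / s) ^ (-(α + 1 / 2)) * heatGaussian s c x y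

lemma heatFactorBound_comm (α s c x y : ℝ) :
    heatFactorBound α s c x y = heatFactorBound α s c y x := by
  rw [heatFactorBound, heatFactorBound, heatGaussian_comm, mul_comm x y]

lemma heatFactorBound_pos (α c : ℝ) {s x y : ℝ} (hs : 0 < s) (hx : 0 < x) (hy : 0 < y) :
    0 < heatFactorBound α s c x y := by
  have := heatGaussian_pos s c x y
  rw [heatFactorBound]
  positivity

lemma exists_abs_heatFactor_le {α : ℝ} {e : ℕ} (h : -(1 / 2) ≤ α + e) :
    ∃ C : ℝ, 0 < C ∧ ∀ s c x y : ℝ, 0 < s → 0 < x → 0 < y →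
      |heatFactor α e s c x y| ≤ C * heatFactorBound α s c x y := by
  obtain ⟨C, hC, hb⟩ := exists_abs_scaledBessel_le h
  refine ⟨1 / 2 * C, by positivity, fun s c x y hs hx hy => ?_⟩
  have hG := heatGaussian_pos s c x y
  rw [heatFactor, abs_mul, abs_mul _ (scaledBessel _ _ _), abs_of_pos (by positivity),
    abs_of_pos hG, heatFactorBound]
  calc _ ≤ 1 / 2 * s ^ (-(1 + α)) * (heatGaussian s c x y *
        (C * (1 + x * y / s) ^ (-(α + 1 / 2)))) := by gcongr; exact hb _ (by positivity)
    _ = _ := by ring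

lemma exists_abs_heatFactorDeriv_le {α : ℝ} {e : ℕ} (h : -(1 / 2) ≤ α + e) :
    ∃ C : ℝ, 0 < C ∧ ∀ s c x y : ℝ, 0 < s → 1 ≤ c → 0 < x → 0 < y →
      |heatFactorDeriv α e s c x y| ≤ C * heatFactorBound α s c x y *
        (y / s / (1 + x * y / s) + |x - y| / s + (c - 1) / s * x) := by
  obtain ⟨C₀, hC₀, h₀⟩ := exists_abs_scaledBessel_le h
  obtain ⟨C₁, hC₁, h₁⟩ := exists_abs_deriv_scaledBessel_mul_le h
  refine ⟨1 / 2 * (C₀ + C₁), by positivity, fun s c x y hs hc hx hy => ?_⟩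
  have hG := heatGaussian_pos s c x y
  have hz : 0 ≤ x * y / s := by positivity
  rw [heatFactorDeriv, abs_mul, abs_mul (heatGaussian _ _ _ _), abs_of_pos (by positivity),
    abs_of_pos hG, heatFactorBound]
  set z := x * y / s
  set b := (1 + z) ^ (-(α + 1 / 2))
  have hderiv : |deriv (scaledBessel α e) z| ≤ C₁ * b / (1 + z) :=
    (le_div_iff₀ (by positivity)).mpr (h₁ z hz)
  have hcoef : |(x - y) / s + (c - 1) / s * x| ≤ |x - y| / s + (c - 1) / s * x := by
    refine (abs_add_le _ _).trans_eq ?_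
    rw [abs_div, abs_of_pos hs, abs_of_nonneg (a := (c - 1) / s * x) (by positivity)]
  calc _ ≤ 1 / 2 * s ^ (-(1 + α)) * (heatGaussian s c x y *
          (y / s * (C₁ * b / (1 + z)) + (|x - y| / s + (c - 1) / s * x) * (C₀ * b))) := by
        gcongr
        refine (abs_sub _ _).trans ?_
        rw [abs_mul, abs_mul, abs_of_pos (by positivity : 0 < y / s)]
        gcongr
        exact h₀ z hz
    _ ≤ 1 / 2 * s ^ (-(1 + α)) * (heatGaussian s c x y *
          (y / s * ((C₀ + C₁) * b / (1 + z)) +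
            (|x - y| / s + (c - 1) / s * x) * ((C₀ + C₁) * b))) := by
        gcongr <;> linarith
    _ = _ := by ring

lemma add_sq_le_mul_one_add {s x y r : ℝ} (hs : 0 < s) (hx : 0 ≤ x) (hy : 0 ≤ y)
    (hr : |x - y| ≤ r) : (x + r) ^ 2 ≤ 4 * (1 + r ^ 2 / s) * (s * (1 + x * y / s)) := by
  have hsq : (x - y) ^ 2 ≤ r ^ 2 := sq_le_sq' (abs_le.mp hr).1 (abs_le.mp hr).2
  have hrest : 0 ≤ 4 * s + 4 * (r ^ 2 / s * (x * y)) := by positivity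
  calc (x + r) ^ 2 ≤ 4 * (x * y) + 4 * r ^ 2 := by nlinarith [sq_nonneg (x - r), sq_nonneg y]
    _ ≤ 4 * (x * y) + 4 * r ^ 2 + (4 * s + 4 * (r ^ 2 / s * (x * y))) :=
        le_add_of_nonneg_right hrest
    _ = _ := by field_simp; ring

lemma rpow_neg_mul_rpow_neg_le {α s x y r : ℝ} (hα : -(1 / 2) ≤ α) (hs : 0 < s) (hx : 0 < x)
    (hy : 0 ≤ y) (hr : |x - y| ≤ r) :
    s ^ (-(1 + α)) * (1 + x * y / s) ^ (-(α + 1 / 2)) ≤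
      s ^ (-(1 / 2) : ℝ) * (4 * (1 + r ^ 2 / s)) ^ (α + 1 / 2) * ((x + r) ^ (2 * α + 1))⁻¹ := by
  have hr0 : 0 ≤ r := (abs_nonneg _).trans hr
  have ha : 0 ≤ α + 1 / 2 := by linarith
  have hsquare : (x + r) ^ (2 * α + 1) = ((x + r) ^ 2) ^ (α + 1 / 2) := by
    rw [← rpow_natCast, ← rpow_mul (by positivity)]
    congr 1
    push_cast
    ring
  have hle : (x + r) ^ (2 * α + 1) ≤
      (4 * (1 + r ^ 2 / s)) ^ (α + 1 / 2) * (s * (1 + x * y / s)) ^ (α + 1 / 2) := by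
    rw [hsquare, ← mul_rpow (by positivity) (by positivity)]
    exact rpow_le_rpow (by positivity) (add_sq_le_mul_one_add hs hx.le hy hr) ha
  calc s ^ (-(1 + α)) * (1 + x * y / s) ^ (-(α + 1 / 2))
      = s ^ (-(1 / 2) : ℝ) * ((s * (1 + x * y / s)) ^ (α + 1 / 2))⁻¹ := by
        rw [show -(1 + α) = -(1 / 2) + -(α + 1 / 2) by ring, rpow_add hs, mul_assoc,
          ← mul_rpow hs.le (by positivity), rpow_neg (by positivity) (α + 1 / 2)]
    _ ≤ s ^ (-(1 / 2) : ℝ) *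
          ((4 * (1 + r ^ 2 / s)) ^ (α + 1 / 2) * ((x + r) ^ (2 * α + 1))⁻¹) := by
        gcongr
        rw [← div_eq_mul_inv, le_div_iff₀ (by positivity), inv_mul_le_iff₀ (by positivity)]
        exact hle.trans_eq (mul_comm _ _)
    _ = _ := by ring

lemma mul_div_one_add_le {s x y r : ℝ} (hs : 0 < s) (hx : 0 ≤ x) (hy : 0 ≤ y)
    (hr : |x - y| ≤ r) : r * (y / s / (1 + x * y / s)) ≤ 2 * (1 + r ^ 2 / s) := by
  have hsq : (x - y) ^ 2 ≤ r ^ 2 := sq_le_sq' (abs_le.mp hr).1 (abs_le.mp hr).2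
  have hry : r * y ≤ r ^ 2 + x * y := by
    nlinarith [sq_nonneg (r - y)]
  rw [div_div, ← mul_div_assoc, div_le_iff₀ (by positivity)]
  calc r * y ≤ r ^ 2 + x * y := hry
    _ ≤ r ^ 2 + x * y + (2 * s + x * y + r ^ 2 + 2 * (r ^ 2 / s * (x * y))) :=
        le_add_of_nonneg_right (by positivity)
    _ = _ := by field_simp; ring

lemma exists_one_add_rpow_mul_exp_neg_le (p : ℝ) {δ : ℝ} (hδ : 0 < δ) :
    ∃ C : ℝ, 0 < C ∧ ∀ u : ℝ, 0 ≤ u → (1 + u) ^ p * exp (-(δ * u)) ≤ C := by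
  obtain ⟨n, hn⟩ := exists_nat_ge p
  refine ⟨n.factorial / δ ^ n * exp δ, by positivity, fun u hu => ?_⟩
  calc (1 + u) ^ p * exp (-(δ * u))
      ≤ (1 + u) ^ n * exp (-(δ * u)) := by
        gcongr
        rw [← rpow_natCast]
        exact rpow_le_rpow_of_exponent_le (by linarith) hn
    _ = n.factorial / δ ^ n * ((δ * (1 + u)) ^ n / n.factorial) * exp (-(δ * u)) := by
        rw [mul_pow]; field_simp
    _ ≤ n.factorial / δ ^ n * exp (δ * (1 + u)) * exp (-(δ * u)) := by
        gcongr
        exact pow_div_factorial_le_exp _ (by positivity) n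
    _ = n.factorial / δ ^ n * exp δ := by rw [mul_assoc _ (exp _), ← exp_add]; ring_nf

lemma exp_neg_mul_one_add_le (q : ℝ) : exp (-q) * (1 + q) ≤ 2 * exp (-(q / 2)) := by
  calc exp (-q) * (1 + q) ≤ exp (-q) * (2 * exp (q / 2)) := by
        gcongr
        linarith [add_one_le_exp (q / 2)]
    _ = 2 * exp (-(q / 2)) := by rw [mul_left_comm, ← exp_add]; ring_nf

lemma rpow_neg_mul_one_add_div_rpow {s q : ℝ} (hs : 0 < s) (hq : 0 ≤ q) (D : ℝ) :
    s ^ (-D) * (1 + q / s) ^ (-(D + 1)) = s * (s + q) ^ (-(D + 1)) := by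
  rw [show s + q = s * (1 + q / s) by field_simp, mul_rpow hs.le (by positivity), ← mul_assoc,
    neg_add, rpow_add hs (-D), rpow_neg_one, mul_left_comm, mul_inv_cancel₀ hs.ne', mul_one]

/-! ### The heat kernel and its gradient -/

lemma norm_smul_add_smul_le_add_abs {E : Type*} [SeminormedAddCommGroup E] [NormedSpace ℝ E]
    {u v : E} (hu : ‖u‖ ≤ 1) (hv : ‖v‖ ≤ 1) (a b : ℝ) : ‖a • u + b • v‖ ≤ |a| + |b| := by
  refine (norm_add_le _ _).trans (add_le_add ?_ ?_) <;> rw [norm_smul, norm_eq_abs]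
  · exact mul_le_of_le_one_right (abs_nonneg a) hu
  · exact mul_le_of_le_one_right (abs_nonneg b) hv

lemma norm_sum_prod_erase_smul_le {ι E : Type*} [DecidableEq ι] [SeminormedAddCommGroup E]
    [NormedSpace ℝ E] {s : Finset ι} {f b : ι → ℝ} {L : ι → E} {T : ℝ}
    (hf : ∀ i ∈ s, |f i| ≤ b i) (hL : ∀ i ∈ s, ‖L i‖ ≤ b i * T) :
    ‖∑ i ∈ s, (∏ j ∈ s.erase i, f j) • L i‖ ≤ s.card * ((∏ i ∈ s, b i) * T) := by
  rw [← nsmul_eq_mul, ← Finset.sum_const]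
  refine norm_sum_le_of_le s fun i hi => ?_
  have hprod : |∏ j ∈ s.erase i, f j| ≤ ∏ j ∈ s.erase i, b j := by
    rw [Finset.abs_prod]
    exact Finset.prod_le_prod (fun j _ => abs_nonneg _)
      fun j hj => hf j (Finset.mem_of_mem_erase hj)
  rw [norm_smul, ← Finset.prod_erase_mul _ _ hi, mul_assoc]
  exact mul_le_mul hprod (hL i hi) (norm_nonneg _) ((abs_nonneg _).trans hprod)

variable {d : ℕ}

/-- The product `∏ (x_i + r) ^ (2 α_i + 1)`, the size of the weight on the ball `B(x, r)`. -/
def shiftedWeight (α : Fin d → ℝ) (x : EuclideanSpace ℝ (Fin d)) (r : ℝ) : ℝ :=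
  ∏ i, (x i + r) ^ (2 * α i + 1)

/-- The exponent of the Gaussian factor of the heat kernel, with `s = sinh 2t` and
`c = cosh 2t`. -/
def heatExponent (s c : ℝ) (x y : EuclideanSpace ℝ (Fin d)) : ℝ :=
  ‖x - y‖ ^ 2 / (2 * s) + (c - 1) / (2 * s) * (‖x‖ ^ 2 + ‖y‖ ^ 2)

lemma shiftedWeight_pos (α : Fin d → ℝ) {x : EuclideanSpace ℝ (Fin d)} (hx : x ∈ orthant d)
    {r : ℝ} (hr : 0 ≤ r) : 0 < shiftedWeight α x r :=
  Finset.prod_pos fun i _ => rpow_pos_of_pos (add_pos_of_pos_of_nonneg (hx i) hr) _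

lemma heatExponent_nonneg {s c : ℝ} (hs : 0 ≤ s) (hc : 1 ≤ c) (x y : EuclideanSpace ℝ (Fin d)) :
    0 ≤ heatExponent s c x y :=
  add_nonneg (by positivity)
    (mul_nonneg (div_nonneg (sub_nonneg.mpr hc) (by positivity)) (by positivity))

lemma heatExponent_comm (s c : ℝ) (x y : EuclideanSpace ℝ (Fin d)) :
    heatExponent s c x y = heatExponent s c y x := by
  rw [heatExponent, heatExponent, norm_sub_rev, add_comm (‖x‖ ^ 2)]

lemma abs_sub_apply_le_norm_sub (x y : EuclideanSpace ℝ (Fin d)) (i : Fin d) :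
    |x i - y i| ≤ ‖x - y‖ := by
  simpa using PiLp.norm_apply_le (x - y) i

lemma prod_heatGaussian (s c : ℝ) (x y : EuclideanSpace ℝ (Fin d)) :
    ∏ i, heatGaussian s c (x i) (y i) = exp (-heatExponent s c x y) := by
  simp only [heatGaussian, heatExponent, ← exp_sum, EuclideanSpace.real_norm_sq_eq,
    Finset.sum_sub_distrib, Finset.sum_neg_distrib, ← Finset.sum_div, ← Finset.mul_sum,
    Finset.sum_add_distrib, PiLp.sub_apply, neg_add']

lemma prod_rpow_neg_mul_rpow_neg_le {α : Fin d → ℝ} (hα : ∀ i, -(1 / 2) ≤ α i) {s : ℝ}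
    (hs : 0 < s) {x y : EuclideanSpace ℝ (Fin d)} (hx : x ∈ orthant d) (hy : y ∈ orthant d) :
    ∏ i, s ^ (-(1 + α i)) * (1 + x i * y i / s) ^ (-(α i + 1 / 2)) ≤
      s ^ (-((d : ℝ) / 2)) * (4 * (1 + ‖x - y‖ ^ 2 / s)) ^ (∑ i, (α i + 1 / 2)) *
        (shiftedWeight α x ‖x - y‖)⁻¹ := by
  calc _ ≤ ∏ i, s ^ (-(1 / 2) : ℝ) * (4 * (1 + ‖x - y‖ ^ 2 / s)) ^ (α i + 1 / 2) *
        ((x i + ‖x - y‖) ^ (2 * α i + 1))⁻¹ := by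
        refine Finset.prod_le_prod (fun i _ => ?_) fun i _ =>
          rpow_neg_mul_rpow_neg_le (hα i) hs (hx i) (hy i).le (abs_sub_apply_le_norm_sub x y i)
        have := hx i
        have := hy i
        positivity
    _ = _ := by
        rw [Finset.prod_mul_distrib, Finset.prod_mul_distrib, ← rpow_sum_of_pos hs,
          ← rpow_sum_of_pos (by positivity), Finset.prod_inv_distrib, shiftedWeight,
          Finset.sum_const, Finset.card_univ, Fintype.card_fin, nsmul_eq_mul]
        ring_nf

lemma exists_prod_heatFactorBound_mul_le {α : Fin d → ℝ} (hα : ∀ i, -(1 / 2) ≤ α i) :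
    ∃ C : ℝ, 0 < C ∧ ∀ s c : ℝ, 0 < s → 1 ≤ c → ∀ x ∈ orthant d, ∀ y ∈ orthant d,
      (∏ i, heatFactorBound (α i) s c (x i) (y i)) * (1 + heatExponent s c x y) ≤
        C * (shiftedWeight α x ‖x - y‖)⁻¹ *
          (s * (s + ‖x - y‖ ^ 2) ^ (-((d : ℝ) / 2 + 1))) := by
  set A : ℝ := ∑ i, (α i + 1 / 2)
  obtain ⟨C, hC, hb⟩ := exists_one_add_rpow_mul_exp_neg_le (A + (d / 2 + 1))
    (by norm_num : (0 : ℝ) < 1 / 4)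
  refine ⟨4 ^ A * 2 * C, by positivity, fun s c hs hc x hx y hy => ?_⟩
  have hQ := heatExponent_nonneg hs.le hc x y
  set u := ‖x - y‖ ^ 2 / s with hu
  set W := shiftedWeight α x ‖x - y‖
  have hu0 : 0 ≤ u := by positivity
  have hW : 0 < W := shiftedWeight_pos α hx (norm_nonneg _)
  have hexp : exp (-heatExponent s c x y) * (1 + heatExponent s c x y) ≤
      2 * exp (-(1 / 4 * u)) := by
    refine (exp_neg_mul_one_add_le _).trans ?_
    gcongr
    have hrest : 0 ≤ (c - 1) / (2 * s) * (‖x‖ ^ 2 + ‖y‖ ^ 2) :=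
      mul_nonneg (div_nonneg (by linarith) (by positivity)) (by positivity)
    have hsplit : ‖x - y‖ ^ 2 / (2 * s) = u / 2 := by rw [hu]; ring
    rw [heatExponent, hsplit]
    linarith
  have hdecay : (1 + u) ^ A * exp (-(1 / 4 * u)) ≤ C * (1 + u) ^ (-((d : ℝ) / 2 + 1)) := by
    rw [rpow_neg (by positivity), ← div_eq_mul_inv, le_div_iff₀ (by positivity), mul_right_comm,
      ← rpow_add (by positivity)]
    exact hb u hu0
  simp only [heatFactorBound]
  rw [Finset.prod_mul_distrib, prod_heatGaussian, mul_assoc]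
  calc _ ≤ s ^ (-((d : ℝ) / 2)) * (4 * (1 + u)) ^ A * W⁻¹ * (2 * exp (-(1 / 4 * u))) := by
        gcongr
        exact prod_rpow_neg_mul_rpow_neg_le hα hs hx hy
    _ = 4 ^ A * 2 * s ^ (-((d : ℝ) / 2)) * W⁻¹ * ((1 + u) ^ A * exp (-(1 / 4 * u))) := by
        rw [mul_rpow (by positivity) (by positivity)]; ring
    _ ≤ 4 ^ A * 2 * s ^ (-((d : ℝ) / 2)) * W⁻¹ * (C * (1 + u) ^ (-((d : ℝ) / 2 + 1))) := by
        gcongr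
    _ = 4 ^ A * 2 * C * W⁻¹ * (s ^ (-((d : ℝ) / 2)) * (1 + u) ^ (-((d : ℝ) / 2 + 1))) := by ring
    _ = _ := by rw [hu, rpow_neg_mul_one_add_div_rpow hs (by positivity)]

lemma heatFactorDeriv_growth_le {s c : ℝ} (hs : 0 < s) (hc : 1 ≤ c)
    {x y : EuclideanSpace ℝ (Fin d)} (hx : x ∈ orthant d) (hy : y ∈ orthant d) (i : Fin d) :
    ‖x - y‖ * (y i / s / (1 + x i * y i / s) + |x i - y i| / s + (c - 1) / s * x i) ≤
      6 * (1 + heatExponent s c x y) := by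
  have hbessel := mul_div_one_add_le hs (hx i).le (hy i).le (abs_sub_apply_le_norm_sub x y i)
  have hdiff : ‖x - y‖ * (|x i - y i| / s) ≤ ‖x - y‖ ^ 2 / s := by
    rw [sq, mul_div_assoc]
    gcongr
    exact abs_sub_apply_le_norm_sub x y i
  have hxi : ‖x - y‖ * x i ≤ 3 / 2 * (‖x‖ ^ 2 + ‖y‖ ^ 2) := by
    calc ‖x - y‖ * x i ≤ (‖x‖ + ‖y‖) * ‖x‖ :=
          mul_le_mul (norm_sub_le x y) ((le_abs_self _).trans (PiLp.norm_apply_le x i)) (hx i).le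
            (by positivity)
      _ ≤ _ := by nlinarith [sq_nonneg (‖x‖ - ‖y‖), sq_nonneg ‖y‖]
  have hcoef : 0 ≤ (c - 1) / s := div_nonneg (by linarith) hs.le
  have hcxi := mul_le_mul_of_nonneg_left hxi hcoef
  have hrest : 0 ≤ (c - 1) / s * (‖x‖ ^ 2 + ‖y‖ ^ 2) := by positivity
  have hexponent : heatExponent s c x y =
      ‖x - y‖ ^ 2 / s / 2 + (c - 1) / s * (‖x‖ ^ 2 + ‖y‖ ^ 2) / 2 := by
    rw [heatExponent]; ring
  rw [hexponent]
  linarith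

lemma exists_abs_heatFactorDeriv_le_div_norm_sub {a : ℝ} {n : ℕ} (h : -(1 / 2) ≤ a + n) :
    ∃ C : ℝ, 0 < C ∧ ∀ s c : ℝ, 0 < s → 1 ≤ c → ∀ x ∈ orthant d, ∀ y ∈ orthant d, x ≠ y →
      ∀ i, |heatFactorDeriv a n s c (x i) (y i)| ≤
        C * heatFactorBound a s c (x i) (y i) * ((1 + heatExponent s c x y) / ‖x - y‖) := by
  obtain ⟨C, hC, hb⟩ := exists_abs_heatFactorDeriv_le h
  refine ⟨C * 6, by positivity, fun s c hs hc x hx y hy hxy i => ?_⟩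
  have hbound : 0 < heatFactorBound a s c (x i) (y i) := heatFactorBound_pos _ _ hs (hx i) (hy i)
  calc _ ≤ C * heatFactorBound a s c (x i) (y i) * _ := hb s c _ _ hs hc (hx i) (hy i)
    _ ≤ C * heatFactorBound a s c (x i) (y i) * (6 * (1 + heatExponent s c x y) / ‖x - y‖) := by
        gcongr
        rw [le_div_iff₀' (norm_sub_pos_iff.mpr hxy)]
        exact heatFactorDeriv_growth_le hs hc hx hy i
    _ = _ := by ring

section HeatProd

variable (α : Fin d → ℝ) (e : Fin d → ℕ)

/-- The heat kernel as a product over the coordinates, with `s = sinh 2t`, `c = cosh 2t` and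
`p = (x, y)`. -/
def heatProd (s c : ℝ) (p : EuclideanSpace ℝ (Fin d) × EuclideanSpace ℝ (Fin d)) : ℝ :=
  ∏ i, heatFactor (α i) (e i) s c (p.1 i) (p.2 i)

/-- The coordinate `x_i` of a pair `(x, y)`, as a linear functional. -/
def fstCoord (i : Fin d) : EuclideanSpace ℝ (Fin d) × EuclideanSpace ℝ (Fin d) →L[ℝ] ℝ :=
  (EuclideanSpace.proj i).comp (ContinuousLinearMap.fst ℝ _ _)

/-- The coordinate `y_i` of a pair `(x, y)`, as a linear functional. -/
def sndCoord (i : Fin d) : EuclideanSpace ℝ (Fin d) × EuclideanSpace ℝ (Fin d) →L[ℝ] ℝ :=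
  (EuclideanSpace.proj i).comp (ContinuousLinearMap.snd ℝ _ _)

/-- The total derivative of `heatProd`, given by the product rule. -/
def heatProdDeriv (s c : ℝ) (p : EuclideanSpace ℝ (Fin d) × EuclideanSpace ℝ (Fin d)) :
    EuclideanSpace ℝ (Fin d) × EuclideanSpace ℝ (Fin d) →L[ℝ] ℝ :=
  ∑ i, (∏ j ∈ Finset.univ.erase i, heatFactor (α j) (e j) s c (p.1 j) (p.2 j)) •
    (heatFactorDeriv (α i) (e i) s c (p.1 i) (p.2 i) • fstCoord i +
      heatFactorDeriv (α i) (e i) s c (p.2 i) (p.1 i) • sndCoord i)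

lemma norm_fstCoord_le (i : Fin d) : ‖fstCoord i‖ ≤ 1 :=
  ContinuousLinearMap.opNorm_le_bound _ zero_le_one fun v =>
    ((PiLp.norm_apply_le v.1 i).trans (norm_fst_le v)).trans_eq (one_mul _).symm

lemma norm_sndCoord_le (i : Fin d) : ‖sndCoord i‖ ≤ 1 :=
  ContinuousLinearMap.opNorm_le_bound _ zero_le_one fun v =>
    ((PiLp.norm_apply_le v.2 i).trans (norm_snd_le v)).trans_eq (one_mul _).symm

lemma hasFDerivAt_heatProd (s c : ℝ)
    (p : EuclideanSpace ℝ (Fin d) × EuclideanSpace ℝ (Fin d)) :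
    HasFDerivAt (heatProd α e s c) (heatProdDeriv α e s c p) p :=
  HasFDerivAt.finsetProd fun i _ => hasFDerivAt_heatFactor (α i) (e i) s c
    (fstCoord i).hasFDerivAt (sndCoord i).hasFDerivAt

lemma exists_norm_heatFactorDeriv_smul_add_smul_le {a : ℝ} {n : ℕ} (h : -(1 / 2) ≤ a + n) :
    ∃ C : ℝ, 0 < C ∧ ∀ s c : ℝ, 0 < s → 1 ≤ c → ∀ x ∈ orthant d, ∀ y ∈ orthant d, x ≠ y → ∀ i,
      ‖heatFactorDeriv a n s c (x i) (y i) • fstCoord i +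
          heatFactorDeriv a n s c (y i) (x i) • sndCoord i‖ ≤
        C * heatFactorBound a s c (x i) (y i) * ((1 + heatExponent s c x y) / ‖x - y‖) := by
  obtain ⟨C, hC, hb⟩ := exists_abs_heatFactorDeriv_le_div_norm_sub (d := d) h
  refine ⟨2 * C, by positivity, fun s c hs hc x hx y hy hxy i => ?_⟩
  have hfst := hb s c hs hc x hx y hy hxy i
  have hsnd := hb s c hs hc y hy x hx hxy.symm i
  rw [heatFactorBound_comm, heatExponent_comm, norm_sub_rev] at hsnd
  refine (norm_smul_add_smul_le_add_abs (norm_fstCoord_le i) (norm_sndCoord_le i) _ _).trans ?_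
  linarith

variable {α}

lemma exists_abs_heatProd_le (hα : ∀ i, -(1 / 2) ≤ α i) :
    ∃ C : ℝ, 0 < C ∧ ∀ s c : ℝ, 0 < s → 1 ≤ c → ∀ x ∈ orthant d, ∀ y ∈ orthant d,
      |heatProd α e s c (x, y)| ≤ C * (shiftedWeight α x ‖x - y‖)⁻¹ *
        (s * (s + ‖x - y‖ ^ 2) ^ (-((d : ℝ) / 2 + 1))) := by
  choose K hK hfac using fun i =>
    exists_abs_heatFactor_le (le_add_of_le_of_nonneg (hα i) (e i).cast_nonneg)
  obtain ⟨C, hC, hb⟩ := exists_prod_heatFactorBound_mul_le hα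
  have hKpos : 0 < ∏ i, K i := Finset.prod_pos fun i _ => hK i
  refine ⟨(∏ i, K i) * C, by positivity, fun s c hs hc x hx y hy => ?_⟩
  calc |heatProd α e s c (x, y)|
      = ∏ i, |heatFactor (α i) (e i) s c (x i) (y i)| := Finset.abs_prod _ _
    _ ≤ ∏ i, K i * heatFactorBound (α i) s c (x i) (y i) :=
        Finset.prod_le_prod (fun i _ => abs_nonneg _) fun i _ => hfac i s c _ _ hs (hx i) (hy i)
    _ = (∏ i, K i) * ((∏ i, heatFactorBound (α i) s c (x i) (y i)) * 1) := by
        rw [Finset.prod_mul_distrib, mul_one]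
    _ ≤ (∏ i, K i) * ((∏ i, heatFactorBound (α i) s c (x i) (y i)) *
          (1 + heatExponent s c x y)) := by
        gcongr
        · exact Finset.prod_nonneg fun i _ => (heatFactorBound_pos _ _ hs (hx i) (hy i)).le
        · linarith [heatExponent_nonneg hs.le hc x y]
    _ ≤ _ := by
        rw [mul_assoc, mul_assoc, ← mul_assoc C]
        gcongr ?_ * ?_
        exact hb s c hs hc x hx y hy

lemma exists_norm_heatProdDeriv_le (hα : ∀ i, -(1 / 2) ≤ α i) :
    ∃ C : ℝ, 0 < C ∧ ∀ s c : ℝ, 0 < s → 1 ≤ c → ∀ x ∈ orthant d, ∀ y ∈ orthant d, x ≠ y →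
      ‖heatProdDeriv α e s c (x, y)‖ ≤ C * (‖x - y‖⁻¹ * (shiftedWeight α x ‖x - y‖)⁻¹) *
        (s * (s + ‖x - y‖ ^ 2) ^ (-((d : ℝ) / 2 + 1))) := by
  choose K₀ hK₀ hfac using fun i =>
    exists_abs_heatFactor_le (le_add_of_le_of_nonneg (hα i) (e i).cast_nonneg)
  choose K₁ hK₁ hderiv using fun i =>
    exists_norm_heatFactorDeriv_smul_add_smul_le (d := d)
      (le_add_of_le_of_nonneg (hα i) (e i).cast_nonneg)
  obtain ⟨C, hC, hb⟩ := exists_prod_heatFactorBound_mul_le hα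
  have hK : 0 < ∏ i, (K₀ i + K₁ i) := Finset.prod_pos fun i _ => add_pos (hK₀ i) (hK₁ i)
  refine ⟨(d + 1) * (∏ i, (K₀ i + K₁ i)) * C, by positivity,
    fun s c hs hc x hx y hy hxy => ?_⟩
  set b : Fin d → ℝ := fun i => heatFactorBound (α i) s c (x i) (y i)
  set T : ℝ := (1 + heatExponent s c x y) / ‖x - y‖ with hT
  have hbpos i : 0 < b i := heatFactorBound_pos _ _ hs (hx i) (hy i)
  have hbprod : 0 < ∏ i, b i := Finset.prod_pos fun i _ => hbpos i
  have hQ := heatExponent_nonneg hs.le hc x y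
  have hfactor i : |heatFactor (α i) (e i) s c (x i) (y i)| ≤ (K₀ i + K₁ i) * b i :=
    (hfac i s c _ _ hs (hx i) (hy i)).trans
      (mul_le_mul_of_nonneg_right (by linarith [hK₁ i]) (hbpos i).le)
  have hpartial i : ‖heatFactorDeriv (α i) (e i) s c (x i) (y i) • fstCoord i +
      heatFactorDeriv (α i) (e i) s c (y i) (x i) • sndCoord i‖ ≤ (K₀ i + K₁ i) * b i * T := by
    refine (hderiv i s c hs hc x hx y hy hxy i).trans ?_
    have := hbpos i
    gcongr ?_ * _ * _
    linarith [hK₀ i]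
  calc ‖heatProdDeriv α e s c (x, y)‖
      ≤ d * ((∏ i, (K₀ i + K₁ i) * b i) * T) := by
        simpa only [heatProdDeriv, Finset.card_fin] using norm_sum_prod_erase_smul_le
          (s := Finset.univ) (fun i _ => hfactor i) fun i _ => hpartial i
    _ = d * ((∏ i, (K₀ i + K₁ i)) * ‖x - y‖⁻¹ *
          ((∏ i, b i) * (1 + heatExponent s c x y))) := by
        rw [Finset.prod_mul_distrib, hT]; ring
    _ ≤ (d + 1) * ((∏ i, (K₀ i + K₁ i)) * ‖x - y‖⁻¹ *
          (C * (shiftedWeight α x ‖x - y‖)⁻¹ *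
            (s * (s + ‖x - y‖ ^ 2) ^ (-((d : ℝ) / 2 + 1))))) := by
        gcongr ?_ * (_ * ?_)
        · linarith
        · exact hb s c hs hc x hx y hy
    _ = _ := by ring

end HeatProd

/-! ### Integration in time -/

lemma sinh_le_mul_cosh {u : ℝ} (hu : 0 ≤ u) : sinh u ≤ u * cosh u := by
  have hderiv : ∀ v ∈ interior (Icc 0 u), deriv sinh v ≤ cosh u := fun v hv => by
    obtain ⟨hv₀, hvu⟩ := interior_subset hv
    rw [Real.deriv_sinh, cosh_le_cosh, abs_of_nonneg hv₀, abs_of_nonneg hu]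
    exact hvu
  have hmean := (convex_Icc 0 u).image_sub_le_mul_sub_of_deriv_le continuous_sinh.continuousOn
    differentiable_sinh.differentiableOn hderiv 0 (left_mem_Icc.mpr hu) u (right_mem_Icc.mpr hu) hu
  simpa only [sinh_zero, sub_zero, mul_comm] using hmean

lemma sinh_two_mul_pos {t : ℝ} (ht : 0 < t) : 0 < sinh (2 * t) :=
  sinh_pos_iff.mpr (by positivity)

/-- The majorant in time `(sinh 2t + q) ^ (-(D + 1)) · 2 cosh 2t`, an exact derivative up to a
constant; it is used with `D = d / 2` and `q = ‖x - y‖ ^ 2`. -/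
def timeMajorant (D q t : ℝ) : ℝ :=
  (sinh (2 * t) + q) ^ (-(D + 1)) * (2 * cosh (2 * t))

lemma timeMajorant_nonneg (D : ℝ) {q t : ℝ} (hq : 0 ≤ q) (ht : 0 < t) :
    0 ≤ timeMajorant D q t := by
  have := sinh_two_mul_pos ht
  unfold timeMajorant
  positivity

lemma timeMajorant_anti {D q q' t : ℝ} (hD : 0 ≤ D) (hq : 0 ≤ q) (hqq' : q ≤ q') (ht : 0 < t) :
    timeMajorant D q' t ≤ timeMajorant D q t := by
  have := sinh_two_mul_pos ht
  unfold timeMajorant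
  gcongr ?_ * _
  exact rpow_le_rpow_of_nonpos (by positivity) (by gcongr) (by linarith)

lemma mul_sinh_mul_rpow_le_timeMajorant {D q t a M : ℝ} (hq : 0 ≤ q) (ht : 0 < t) (ha : 0 ≤ a)
    (haM : a ≤ M / t) :
    a * (sinh (2 * t) * (sinh (2 * t) + q) ^ (-(D + 1))) ≤ M * timeMajorant D q t := by
  have hM : 0 ≤ M := by simpa [ht.ne'] using mul_nonneg (ha.trans haM) ht.le
  have hsinh : sinh (2 * t) / t ≤ 2 * cosh (2 * t) := by
    rw [div_le_iff₀ ht]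
    linarith [sinh_le_mul_cosh (show 0 ≤ 2 * t by positivity)]
  calc _ ≤ M / t * (sinh (2 * t) * (sinh (2 * t) + q) ^ (-(D + 1))) := by gcongr
    _ = M * ((sinh (2 * t) + q) ^ (-(D + 1)) * (sinh (2 * t) / t)) := by ring
    _ ≤ M * timeMajorant D q t := by unfold timeMajorant; gcongr

section TimeIntegral

variable {D q : ℝ}

lemma hasDerivAt_timeMajorant_primitive (hD : D ≠ 0) (hq : 0 < q) {t : ℝ} (ht : 0 ≤ t) :
    HasDerivAt (fun t => -D⁻¹ * (sinh (2 * t) + q) ^ (-D)) (timeMajorant D q t) t := by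
  have hbase : HasDerivAt (fun t => sinh (2 * t) + q) (cosh (2 * t) * (2 * 1)) t :=
    (((hasDerivAt_id t).const_mul 2).sinh).add_const q
  refine ((hbase.rpow_const (p := -D) (Or.inl (by positivity))).const_mul (-D⁻¹)).congr_deriv ?_
  rw [timeMajorant, show -D - 1 = -(D + 1) by ring]
  field_simp

lemma tendsto_timeMajorant_primitive (hD : 0 < D) :
    Filter.Tendsto (fun t => -D⁻¹ * (sinh (2 * t) + q) ^ (-D)) Filter.atTop (nhds 0) := by
  have hbase : Filter.Tendsto (fun t => sinh (2 * t) + q) Filter.atTop Filter.atTop := by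
    refine Filter.tendsto_atTop_mono' _ ?_
      (Filter.tendsto_atTop_add_const_right _ q Filter.tendsto_id)
    filter_upwards [Filter.eventually_ge_atTop 0] with t ht
    have := self_le_sinh_iff.mpr (mul_nonneg two_pos.le ht)
    simp only [id]
    linarith
  simpa only [mul_zero, Function.comp_apply] using
    ((tendsto_rpow_neg_atTop hD).comp hbase).const_mul (-D⁻¹)

lemma integrableOn_timeMajorant (hD : 0 < D) (hq : 0 < q) :
    IntegrableOn (timeMajorant D q) (Ioi 0) :=
  integrableOn_Ioi_deriv_of_nonneg' (fun _ ht => hasDerivAt_timeMajorant_primitive hD.ne' hq ht)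
    (fun _ ht => timeMajorant_nonneg D hq.le ht) (tendsto_timeMajorant_primitive hD)

lemma integral_timeMajorant (hD : 0 < D) (hq : 0 < q) :
    ∫ t in Ioi 0, timeMajorant D q t = D⁻¹ * q ^ (-D) := by
  rw [integral_Ioi_of_hasDerivAt_of_nonneg'
    (fun _ ht => hasDerivAt_timeMajorant_primitive hD.ne' hq ht)
    (fun _ ht => timeMajorant_nonneg D hq.le ht) (tendsto_timeMajorant_primitive hD)]
  simp only [mul_zero, sinh_zero, zero_add, zero_sub, neg_mul, neg_neg]

lemma norm_integral_le_of_le_timeMajorant {E : Type*} [NormedAddCommGroup E] [NormedSpace ℝ E]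
    (hD : 0 < D) (hq : 0 < q) {f : ℝ → E} {K : ℝ}
    (hf : ∀ t, 0 < t → ‖f t‖ ≤ K * timeMajorant D q t) :
    ‖∫ t in Ioi 0, f t‖ ≤ K * (D⁻¹ * q ^ (-D)) := by
  rw [← integral_timeMajorant hD hq, ← integral_const_mul]
  refine norm_integral_le_of_norm_le ((integrableOn_timeMajorant hD hq).const_mul K) ?_
  filter_upwards [ae_restrict_mem measurableSet_Ioi] with t ht using hf t ht

end TimeIntegral

/-! ### Volume of balls in the orthant -/

lemma isOpen_orthant : IsOpen (orthant d) := by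
  simp only [orthant, ofPred_forall]
  exact isOpen_iInter_of_finite fun i =>
    isOpen_lt continuous_const (EuclideanSpace.proj (𝕜 := ℝ) i).continuous

lemma isOpen_orthantBall (x : EuclideanSpace ℝ (Fin d)) (r : ℝ) : IsOpen (orthantBall x r) :=
  Metric.isOpen_ball.inter isOpen_orthant

lemma weight_pos (α : Fin d → ℝ) {x : EuclideanSpace ℝ (Fin d)} (hx : x ∈ orthant d) :
    0 < weight α x :=
  Finset.prod_pos fun i _ => rpow_pos_of_pos (abs_pos.mpr (hx i).ne') _

lemma weightMeasure_orthantBall (α : Fin d → ℝ) (x : EuclideanSpace ℝ (Fin d)) (r : ℝ) :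
    weightMeasure α (orthantBall x r) =
      ∫⁻ z in orthantBall x r, ENNReal.ofReal (weight α z) := by
  have hmeas := (isOpen_orthantBall x r).measurableSet
  rw [weightMeasure, withDensity_apply _ hmeas, Measure.restrict_restrict hmeas,
    inter_eq_left.mpr (show orthantBall x r ⊆ orthant d from inter_subset_right)]

lemma weight_le_shiftedWeight {α : Fin d → ℝ} (hα : ∀ i, -(1 / 2) ≤ α i)
    {x z : EuclideanSpace ℝ (Fin d)} {r : ℝ} (hz : z ∈ orthantBall x r) :
    weight α z ≤ shiftedWeight α x r := by
  refine Finset.prod_le_prod (fun i _ => by positivity) fun i _ =>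
    rpow_le_rpow (abs_nonneg _) ?_ (by linarith [hα i])
  have hdist : ‖z - x‖ < r := mem_ball_iff_norm.mp hz.1
  rw [abs_of_pos (hz.2 i)]
  linarith [(abs_le.mp (abs_sub_apply_le_norm_sub z x i)).2]

lemma shiftedWeight_zero_le {α : Fin d → ℝ} (hα : ∀ i, -(1 / 2) ≤ α i)
    {x : EuclideanSpace ℝ (Fin d)} (hx : x ∈ orthant d) {ρ r : ℝ} (hρ : 0 ≤ ρ) (hr : ρ ≤ r) :
    shiftedWeight α 0 ρ ≤ shiftedWeight α x r := by
  simp only [shiftedWeight, PiLp.zero_apply, zero_add]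
  exact Finset.prod_le_prod (fun i _ => by positivity) fun i _ =>
    rpow_le_rpow hρ (by linarith [hx i]) (by linarith [hα i])

/-- The volume of the Euclidean unit ball of `ℝ^d`. -/
def unitBallVolume (d : ℕ) : ℝ :=
  (volume : Measure (EuclideanSpace ℝ (Fin d))).real (Metric.ball 0 1)

lemma unitBallVolume_pos (d : ℕ) : 0 < unitBallVolume d :=
  ENNReal.toReal_pos (Metric.measure_ball_pos _ _ one_pos).ne' measure_ball_lt_top.ne

lemma weightMeasure_orthantBall_le {α : Fin d → ℝ} (hα : ∀ i, -(1 / 2) ≤ α i)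
    (x : EuclideanSpace ℝ (Fin d)) {r : ℝ} (hr : 0 < r) :
    weightMeasure α (orthantBall x r) ≤
      ENNReal.ofReal (unitBallVolume d * r ^ d * shiftedWeight α x r) := by
  have hV := unitBallVolume_pos d
  have hball : volume (Metric.ball x r) =
      ENNReal.ofReal (r ^ d) * volume (Metric.ball (0 : EuclideanSpace ℝ (Fin d)) 1) := by
    rw [Measure.addHaar_ball_of_pos _ _ hr, finrank_euclideanSpace_fin]
  rw [weightMeasure_orthantBall]
  calc ∫⁻ z in orthantBall x r, ENNReal.ofReal (weight α z)
      ≤ ∫⁻ _z in orthantBall x r, ENNReal.ofReal (shiftedWeight α x r) :=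
        setLIntegral_mono' (isOpen_orthantBall x r).measurableSet fun z hz =>
          ENNReal.ofReal_le_ofReal (weight_le_shiftedWeight hα hz)
    _ = ENNReal.ofReal (shiftedWeight α x r) * volume (orthantBall x r) := setLIntegral_const _ _
    _ ≤ ENNReal.ofReal (shiftedWeight α x r) * volume (Metric.ball x r) := by
        gcongr; exact inter_subset_left
    _ = _ := by
        rw [hball, ENNReal.ofReal_mul (by positivity), ENNReal.ofReal_mul hV.le,
          unitBallVolume, measureReal_def, ENNReal.ofReal_toReal measure_ball_lt_top.ne]
        ring

lemma weightMeasure_orthantBall_pos (α : Fin d → ℝ) {x : EuclideanSpace ℝ (Fin d)}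
    (hx : x ∈ orthant d) {r : ℝ} (hr : 0 < r) : 0 < weightMeasure α (orthantBall x r) := by
  have hmeas : Measurable fun z : EuclideanSpace ℝ (Fin d) => ENNReal.ofReal (weight α z) := by
    unfold weight
    fun_prop
  have hsupport : orthantBall x r ⊆ Function.support fun z => ENNReal.ofReal (weight α z) :=
    fun z hz => (ENNReal.ofReal_pos.mpr (weight_pos α hz.2)).ne'
  rw [weightMeasure_orthantBall, setLIntegral_pos_iff hmeas, inter_eq_right.mpr hsupport]
  exact (isOpen_orthantBall x r).measure_pos _ ⟨x, Metric.mem_ball_self hr, hx⟩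

lemma inv_shiftedWeight_mul_le {α : Fin d → ℝ} (hα : ∀ i, -(1 / 2) ≤ α i)
    {x : EuclideanSpace ℝ (Fin d)} (hx : x ∈ orthant d) {r : ℝ} (hr : 0 < r) :
    (shiftedWeight α x r)⁻¹ * (r ^ d)⁻¹ ≤
      unitBallVolume d * (1 / (weightMeasure α).real (orthantBall x r)) := by
  have hV := unitBallVolume_pos d
  have hle := weightMeasure_orthantBall_le hα x hr
  have hW := shiftedWeight_pos α hx hr.le
  have hpos : 0 < (weightMeasure α).real (orthantBall x r) :=
    ENNReal.toReal_pos (weightMeasure_orthantBall_pos α hx hr).ne'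
      (hle.trans_lt ENNReal.ofReal_lt_top).ne
  rw [mul_one_div, ← mul_inv, le_div_iff₀ hpos, ← div_eq_inv_mul, div_le_iff₀ (by positivity)]
  exact (ENNReal.toReal_le_of_le_ofReal (by positivity) hle).trans_eq (by ring)

/-! ### Laplace-type integrals of the heat kernel -/

lemma heatFactor_eq_mul_besselI (α : ℝ) (e : ℕ) {s x y : ℝ} (hs : 0 < s) (hx : 0 < x)
    (hy : 0 < y) (c : ℝ) :
    heatFactor α e s c x y = 1 / (2 * s) * exp (-(1 / 2) * (c / s) * (x ^ 2 + y ^ 2)) *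
      ((x * y) ^ e * (besselI (α + e) (x * y / s) / (x * y) ^ (α + e))) := by
  have hxy : 0 < x * y := by positivity
  have hxyα : (x * y) ^ (α + e) ≠ 0 := by positivity
  rw [besselI_eq_rpow_mul_reducedBesselI _ (by positivity), div_rpow hxy.le hs.le, heatFactor,
    scaledBessel, exp_coth_eq_heatGaussian_mul hs.ne', neg_add, rpow_add hs, rpow_neg_one,
    rpow_neg hs.le, rpow_add hs, rpow_natCast, div_pow]
  field_simp

lemma heatKernel_eq_heatProd (α : Fin d → ℝ) (ε : Fin d → Fin 2) {t : ℝ} (ht : 0 < t)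
    {x y : EuclideanSpace ℝ (Fin d)} (hx : x ∈ orthant d) (hy : y ∈ orthant d) :
    heatKernel α ε t x y =
      heatProd α (fun i => (ε i).val) (sinh (2 * t)) (cosh (2 * t)) (x, y) := by
  rw [heatProd, Finset.prod_congr rfl fun i _ =>
    heatFactor_eq_mul_besselI _ (ε i).val (sinh_two_mul_pos ht) (hx i) (hy i) _,
    Finset.prod_mul_distrib, Finset.prod_mul_distrib, ← exp_sum, ← Finset.mul_sum,
    Finset.sum_add_distrib, ← EuclideanSpace.real_norm_sq_eq, ← EuclideanSpace.real_norm_sq_eq,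
    Finset.prod_const, Finset.card_fin, heatKernel, one_div_pow]

lemma half_dim_pos_of_ne {x y : EuclideanSpace ℝ (Fin d)} (hxy : x ≠ y) : 0 < (d / 2 : ℝ) := by
  rcases d.eq_zero_or_pos with rfl | hd
  · exact absurd (Subsingleton.elim x y) hxy
  · positivity

section LaplaceKernel

variable (α : Fin d → ℝ) (e : Fin d → ℕ) (φ : ℝ → ℂ)

/-- The kernel `G_t(x, y)` times `φ t`, in the product form that is smooth in `p = (x, y)` on the
whole space. -/
def heatIntegrand (p : EuclideanSpace ℝ (Fin d) × EuclideanSpace ℝ (Fin d)) (t : ℝ) : ℂ :=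
  φ t • (heatProd α e (sinh (2 * t)) (cosh (2 * t)) p : ℂ)

/-- The derivative of `heatIntegrand` in `p`. -/
def heatIntegrandDeriv (p : EuclideanSpace ℝ (Fin d) × EuclideanSpace ℝ (Fin d)) (t : ℝ) :
    EuclideanSpace ℝ (Fin d) × EuclideanSpace ℝ (Fin d) →L[ℝ] ℂ :=
  φ t • Complex.ofRealCLM.comp (heatProdDeriv α e (sinh (2 * t)) (cosh (2 * t)) p)

lemma hasFDerivAt_heatIntegrand (p : EuclideanSpace ℝ (Fin d) × EuclideanSpace ℝ (Fin d))
    (t : ℝ) : HasFDerivAt (heatIntegrand α e φ · t) (heatIntegrandDeriv α e φ p t) p :=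
  (Complex.ofRealCLM.hasFDerivAt.comp p (hasFDerivAt_heatProd α e _ _ p)).const_smul (φ t)

lemma measurable_heatFactor (a : ℝ) (n : ℕ) (x y : ℝ) :
    Measurable fun t => heatFactor a n (sinh (2 * t)) (cosh (2 * t)) x y := by
  have := (continuous_scaledBessel a n).measurable
  unfold heatFactor heatGaussian
  fun_prop

lemma measurable_heatFactorDeriv (a : ℝ) (n : ℕ) (x y : ℝ) :
    Measurable fun t => heatFactorDeriv a n (sinh (2 * t)) (cosh (2 * t)) x y := by
  have := (continuous_scaledBessel a n).measurable
  have := measurable_deriv (scaledBessel a n)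
  unfold heatFactorDeriv heatGaussian
  fun_prop

variable {φ} (hφ : Measurable φ)
include hφ

lemma measurable_heatIntegrand (p : EuclideanSpace ℝ (Fin d) × EuclideanSpace ℝ (Fin d)) :
    Measurable (heatIntegrand α e φ p) :=
  hφ.smul (Complex.measurable_ofReal.comp
    (Finset.measurable_fun_prod _ fun _ _ => measurable_heatFactor _ _ _ _))

lemma stronglyMeasurable_heatIntegrandDeriv
    (p : EuclideanSpace ℝ (Fin d) × EuclideanSpace ℝ (Fin d)) :
    StronglyMeasurable (heatIntegrandDeriv α e φ p) := by
  refine hφ.stronglyMeasurable.smul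
    ((continuous_const.clm_comp continuous_id).comp_stronglyMeasurable ?_)
  refine Finset.stronglyMeasurable_fun_sum _ fun i _ => StronglyMeasurable.fun_smul
    (Finset.measurable_fun_prod _ fun _ _ => measurable_heatFactor _ _ _ _).stronglyMeasurable ?_
  exact ((measurable_heatFactorDeriv _ _ _ _).stronglyMeasurable.smul_const _).add
    ((measurable_heatFactorDeriv _ _ _ _).stronglyMeasurable.smul_const _)

omit hφ
variable {α} {M : ℝ} (hα : ∀ i, -(1 / 2) ≤ α i) (hφM : ∀ t, 0 < t → ‖φ t‖ ≤ M / t)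
include hα hφM

lemma exists_norm_heatIntegrand_le :
    ∃ C : ℝ, 0 < C ∧ ∀ x ∈ orthant d, ∀ y ∈ orthant d, ∀ t, 0 < t →
      ‖heatIntegrand α e φ (x, y) t‖ ≤
        C * (shiftedWeight α x ‖x - y‖)⁻¹ * timeMajorant (d / 2) (‖x - y‖ ^ 2) t := by
  obtain ⟨C, hC, hb⟩ := exists_abs_heatProd_le e hα
  have hM : 0 ≤ M := by simpa using (norm_nonneg _).trans (hφM 1 one_pos)
  refine ⟨C * (M + 1), by positivity, fun x hx y hy t ht => ?_⟩
  have hW := shiftedWeight_pos α hx (norm_nonneg (x - y))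
  have hφt : ‖φ t‖ ≤ (M + 1) / t := (hφM t ht).trans (by gcongr; linarith)
  rw [heatIntegrand, norm_smul, Complex.norm_real, norm_eq_abs]
  calc _ ≤ ‖φ t‖ * (C * (shiftedWeight α x ‖x - y‖)⁻¹ *
          (sinh (2 * t) * (sinh (2 * t) + ‖x - y‖ ^ 2) ^ (-((d : ℝ) / 2 + 1)))) := by
        gcongr
        exact hb _ _ (sinh_two_mul_pos ht) (one_le_cosh _) x hx y hy
    _ = C * (shiftedWeight α x ‖x - y‖)⁻¹ * (‖φ t‖ *
          (sinh (2 * t) * (sinh (2 * t) + ‖x - y‖ ^ 2) ^ (-((d : ℝ) / 2 + 1)))) := by ring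
    _ ≤ C * (shiftedWeight α x ‖x - y‖)⁻¹ *
          ((M + 1) * timeMajorant (d / 2) (‖x - y‖ ^ 2) t) := by
        gcongr _ * ?_
        exact mul_sinh_mul_rpow_le_timeMajorant (by positivity) ht (norm_nonneg _) hφt
    _ = _ := by ring

lemma exists_norm_heatIntegrandDeriv_le :
    ∃ C : ℝ, 0 < C ∧ ∀ x ∈ orthant d, ∀ y ∈ orthant d, x ≠ y → ∀ t, 0 < t →
      ‖heatIntegrandDeriv α e φ (x, y) t‖ ≤ C * ‖x - y‖⁻¹ *
        (shiftedWeight α x ‖x - y‖)⁻¹ * timeMajorant (d / 2) (‖x - y‖ ^ 2) t := by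
  obtain ⟨C, hC, hb⟩ := exists_norm_heatProdDeriv_le e hα
  have hM : 0 ≤ M := by simpa using (norm_nonneg _).trans (hφM 1 one_pos)
  refine ⟨C * (M + 1), by positivity, fun x hx y hy hxy t ht => ?_⟩
  have hW := shiftedWeight_pos α hx (norm_nonneg (x - y))
  have hφt : ‖φ t‖ ≤ (M + 1) / t := (hφM t ht).trans (by gcongr; linarith)
  have hcomp (L : EuclideanSpace ℝ (Fin d) × EuclideanSpace ℝ (Fin d) →L[ℝ] ℝ) :
      ‖Complex.ofRealCLM.comp L‖ ≤ ‖L‖ := by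
    simpa only [Complex.ofRealCLM_norm, one_mul] using Complex.ofRealCLM.opNorm_comp_le L
  rw [heatIntegrandDeriv, norm_smul]
  calc _ ≤ ‖φ t‖ * (C * (‖x - y‖⁻¹ * (shiftedWeight α x ‖x - y‖)⁻¹) *
          (sinh (2 * t) * (sinh (2 * t) + ‖x - y‖ ^ 2) ^ (-((d : ℝ) / 2 + 1)))) := by
        gcongr
        exact (hcomp _).trans (hb _ _ (sinh_two_mul_pos ht) (one_le_cosh _) x hx y hy hxy)
    _ = C * (‖x - y‖⁻¹ * (shiftedWeight α x ‖x - y‖)⁻¹) * (‖φ t‖ *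
          (sinh (2 * t) * (sinh (2 * t) + ‖x - y‖ ^ 2) ^ (-((d : ℝ) / 2 + 1)))) := by ring
    _ ≤ C * (‖x - y‖⁻¹ * (shiftedWeight α x ‖x - y‖)⁻¹) *
          ((M + 1) * timeMajorant (d / 2) (‖x - y‖ ^ 2) t) := by
        gcongr _ * ?_
        exact mul_sinh_mul_rpow_le_timeMajorant (by positivity) ht (norm_nonneg _) hφt
    _ = _ := by ring

include hφ

lemma integrableOn_heatIntegrand {x y : EuclideanSpace ℝ (Fin d)} (hx : x ∈ orthant d)
    (hy : y ∈ orthant d) (hxy : x ≠ y) : IntegrableOn (heatIntegrand α e φ (x, y)) (Ioi 0) := by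
  obtain ⟨C, -, hb⟩ := exists_norm_heatIntegrand_le e hα hφM
  have hd := half_dim_pos_of_ne hxy
  have hr : 0 < ‖x - y‖ := norm_sub_pos_iff.mpr hxy
  refine Integrable.mono' ((integrableOn_timeMajorant hd (pow_pos hr 2)).const_mul
    (C * (shiftedWeight α x ‖x - y‖)⁻¹)) (measurable_heatIntegrand α e hφ _).aestronglyMeasurable ?_
  filter_upwards [ae_restrict_mem measurableSet_Ioi] with t ht using hb x hx y hy t ht

lemma hasFDerivAt_integral_heatIntegrand {x y : EuclideanSpace ℝ (Fin d)} (hx : x ∈ orthant d)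
    (hy : y ∈ orthant d) (hxy : x ≠ y) :
    HasFDerivAt (fun p => ∫ t in Ioi 0, heatIntegrand α e φ p t)
      (∫ t in Ioi 0, heatIntegrandDeriv α e φ (x, y) t) (x, y) := by
  obtain ⟨C, hC, hb⟩ := exists_norm_heatIntegrandDeriv_le e hα hφM
  have hd := half_dim_pos_of_ne hxy
  have hr : 0 < ‖x - y‖ := norm_sub_pos_iff.mpr hxy
  set ρ := ‖x - y‖ / 2
  have hρ : 0 < ρ := half_pos hr
  set U : Set (EuclideanSpace ℝ (Fin d) × EuclideanSpace ℝ (Fin d)) :=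
    (orthant d ×ˢ orthant d) ∩ {p | ρ < ‖p.1 - p.2‖}
  have hU : IsOpen U := (isOpen_orthant.prod isOpen_orthant).inter
    (isOpen_lt continuous_const (by fun_prop))
  refine hasFDerivAt_integral_of_dominated_of_fderiv_le
    (hU.mem_nhds ⟨⟨hx, hy⟩, half_lt_self hr⟩)
    (bound := fun t => C * ρ⁻¹ * (shiftedWeight α 0 ρ)⁻¹ * timeMajorant (d / 2) (ρ ^ 2) t)
    (Filter.Eventually.of_forall fun p =>
      (measurable_heatIntegrand α e hφ p).aestronglyMeasurable)
    (integrableOn_heatIntegrand e hφ hα hφM hx hy hxy)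
    (stronglyMeasurable_heatIntegrandDeriv α e hφ _).aestronglyMeasurable ?_
    ((integrableOn_timeMajorant hd (pow_pos hρ 2)).const_mul _)
    (Filter.Eventually.of_forall fun t p _ => hasFDerivAt_heatIntegrand α e φ p t)
  filter_upwards [ae_restrict_mem measurableSet_Ioi] with t ht p ⟨⟨hp₁, hp₂⟩, hp⟩
  have hρp : ρ ≤ ‖p.1 - p.2‖ := le_of_lt hp
  have hW : 0 < shiftedWeight α 0 ρ :=
    Finset.prod_pos fun i _ => by rw [PiLp.zero_apply, zero_add]; positivity
  refine (hb p.1 hp₁ p.2 hp₂ (norm_sub_pos_iff.mp (hρ.trans_le hρp)) t ht).trans ?_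
  have hWle := shiftedWeight_zero_le hα hp₁ hρ.le hρp
  have hWp := hW.trans_le hWle
  have htime := timeMajorant_anti hd.le (sq_nonneg ρ) (pow_le_pow_left₀ hρ.le hρp 2) ht
  have htime₀ := timeMajorant_nonneg (d / 2 : ℝ) (sq_nonneg ‖p.1 - p.2‖) ht
  gcongr

end LaplaceKernel

/-- The kernel `∫_0^∞ G_t^{α,ε}(x, y) φ(t) dt`; the case `φ t = t ^ (iγ - 1) / Γ(iγ)` is
`kernel α ε γ`. -/
def laplaceKernel (α : Fin d → ℝ) (ε : Fin d → Fin 2) (φ : ℝ → ℂ)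
    (x y : EuclideanSpace ℝ (Fin d)) : ℂ :=
  ∫ t in Ioi 0, (heatKernel α ε t x y : ℂ) * φ t

lemma heatKernel_mul_eq_heatIntegrand (α : Fin d → ℝ) (ε : Fin d → Fin 2) (φ : ℝ → ℂ) {t : ℝ}
    (ht : 0 < t) {x y : EuclideanSpace ℝ (Fin d)} (hx : x ∈ orthant d) (hy : y ∈ orthant d) :
    heatKernel α ε t x y * φ t = heatIntegrand α (fun i => (ε i).val) φ (x, y) t := by
  rw [heatKernel_eq_heatProd α ε ht hx hy, heatIntegrand, smul_eq_mul, mul_comm]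

lemma laplaceKernel_eq_integral_heatIntegrand (α : Fin d → ℝ) (ε : Fin d → Fin 2) (φ : ℝ → ℂ)
    {x y : EuclideanSpace ℝ (Fin d)} (hx : x ∈ orthant d) (hy : y ∈ orthant d) :
    laplaceKernel α ε φ x y =
      ∫ t in Ioi 0, heatIntegrand α (fun i => (ε i).val) φ (x, y) t :=
  setIntegral_congr_fun measurableSet_Ioi fun _ ht =>
    heatKernel_mul_eq_heatIntegrand α ε φ ht hx hy

/-- The derivative of `laplaceKernel` at `(x, y)`, obtained under the integral sign. -/
def laplaceKernelDeriv (α : Fin d → ℝ) (ε : Fin d → Fin 2) (φ : ℝ → ℂ)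
    (x y : EuclideanSpace ℝ (Fin d)) :
    EuclideanSpace ℝ (Fin d) × EuclideanSpace ℝ (Fin d) →L[ℝ] ℂ :=
  ∫ t in Ioi 0, heatIntegrandDeriv α (fun i => (ε i).val) φ (x, y) t

lemma hasFDerivAt_laplaceKernel {α : Fin d → ℝ} (hα : ∀ i, -(1 / 2) ≤ α i)
    (ε : Fin d → Fin 2) {φ : ℝ → ℂ} (hφ : Measurable φ) {M : ℝ}
    (hφM : ∀ t, 0 < t → ‖φ t‖ ≤ M / t) {x y : EuclideanSpace ℝ (Fin d)} (hx : x ∈ orthant d)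
    (hy : y ∈ orthant d) (hxy : x ≠ y) :
    HasFDerivAt (Function.uncurry (laplaceKernel α ε φ)) (laplaceKernelDeriv α ε φ x y) (x, y) := by
  refine (hasFDerivAt_integral_heatIntegrand (fun i => (ε i).val) hφ hα hφM hx hy
    hxy).congr_of_eventuallyEq ?_
  filter_upwards [(isOpen_orthant.prod isOpen_orthant).mem_nhds
    (show (x, y) ∈ orthant d ×ˢ orthant d from ⟨hx, hy⟩)] with p hp
  exact laplaceKernel_eq_integral_heatIntegrand α ε φ hp.1 hp.2

lemma norm_integral_le_of_le_shiftedWeight_mul_timeMajorant {E : Type*} [NormedAddCommGroup E]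
    [NormedSpace ℝ E] {α : Fin d → ℝ} (hα : ∀ i, -(1 / 2) ≤ α i) {f : ℝ → E} {K : ℝ}
    (hK : 0 ≤ K) {x y : EuclideanSpace ℝ (Fin d)} (hx : x ∈ orthant d) (hxy : x ≠ y)
    (hf : ∀ t, 0 < t → ‖f t‖ ≤
      K * (shiftedWeight α x ‖x - y‖)⁻¹ * timeMajorant (d / 2) (‖x - y‖ ^ 2) t) :
    ‖∫ t in Ioi 0, f t‖ ≤
      2 * K * unitBallVolume d * (1 / (weightMeasure α).real (orthantBall x ‖y - x‖)) := by
  have hd := half_dim_pos_of_ne hxy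
  have hr : 0 < ‖x - y‖ := norm_sub_pos_iff.mpr hxy
  have hW := shiftedWeight_pos α hx hr.le
  have hd₁ : (1 : ℝ) ≤ d := by exact_mod_cast (by simpa using hd : 0 < d)
  have hinv : (d / 2 : ℝ)⁻¹ ≤ 2 := by
    rw [inv_div]
    exact div_le_self two_pos.le hd₁
  have hpow : (‖x - y‖ ^ 2) ^ (-(d / 2 : ℝ)) = (‖x - y‖ ^ d)⁻¹ := by
    rw [rpow_neg (by positivity), ← rpow_natCast _ 2, ← rpow_mul hr.le, Nat.cast_ofNat,
      mul_div_cancel₀ _ two_ne_zero, rpow_natCast]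
  rw [norm_sub_rev y x]
  calc ‖∫ t in Ioi 0, f t‖
      ≤ K * (shiftedWeight α x ‖x - y‖)⁻¹ * ((d / 2 : ℝ)⁻¹ * (‖x - y‖ ^ d)⁻¹) :=
        hpow ▸ norm_integral_le_of_le_timeMajorant hd (by positivity) hf
    _ ≤ K * (shiftedWeight α x ‖x - y‖)⁻¹ * (2 * (‖x - y‖ ^ d)⁻¹) := by gcongr
    _ = 2 * K * ((shiftedWeight α x ‖x - y‖)⁻¹ * (‖x - y‖ ^ d)⁻¹) := by ring
    _ ≤ 2 * K * (unitBallVolume d * (1 / (weightMeasure α).real (orthantBall x ‖x - y‖))) := by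
        gcongr _ * ?_
        exact inv_shiftedWeight_mul_le hα hx hr
    _ = _ := by ring

lemma gradNorm_le (F : EuclideanSpace ℝ (Fin d) → EuclideanSpace ℝ (Fin d) → ℂ)
    (x y : EuclideanSpace ℝ (Fin d)) :
    gradNorm F x y ≤ √(2 * d) * ‖fderiv ℝ (Function.uncurry F) (x, y)‖ := by
  set L := fderiv ℝ (Function.uncurry F) (x, y)
  have hfst (i : Fin d) : ‖L (EuclideanSpace.single i 1, 0)‖ ^ 2 ≤ ‖L‖ ^ 2 := by
    gcongr
    exact L.unit_le_opNorm _ (by simp [Prod.norm_def])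
  have hsnd (i : Fin d) : ‖L (0, EuclideanSpace.single i 1)‖ ^ 2 ≤ ‖L‖ ^ 2 := by
    gcongr
    exact L.unit_le_opNorm _ (by simp [Prod.norm_def])
  refine sqrt_le_iff.mpr ⟨by positivity, ?_⟩
  rw [mul_pow, sq_sqrt (by positivity)]
  refine (add_le_add (Finset.sum_le_sum fun i _ => hfst i)
    (Finset.sum_le_sum fun i _ => hsnd i)).trans_eq ?_
  rw [Finset.sum_const, Finset.card_fin, nsmul_eq_mul]
  ring

section Bounds

variable {α : Fin d → ℝ} (hα : ∀ i, -(1 / 2) ≤ α i) (ε : Fin d → Fin 2) {φ : ℝ → ℂ} {M : ℝ}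
  (hφM : ∀ t, 0 < t → ‖φ t‖ ≤ M / t)
include hα hφM

lemma exists_norm_laplaceKernel_le :
    ∃ C : ℝ, 0 < C ∧ ∀ x ∈ orthant d, ∀ y ∈ orthant d, x ≠ y →
      ‖laplaceKernel α ε φ x y‖ ≤
        C * (1 / (weightMeasure α).real (orthantBall x ‖y - x‖)) := by
  obtain ⟨C, hC, hb⟩ := exists_norm_heatIntegrand_le (fun i => (ε i).val) hα hφM
  have hV := unitBallVolume_pos d
  refine ⟨2 * C * unitBallVolume d, by positivity, fun x hx y hy hxy => ?_⟩
  rw [laplaceKernel_eq_integral_heatIntegrand α ε φ hx hy]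
  exact norm_integral_le_of_le_shiftedWeight_mul_timeMajorant hα hC.le hx hxy (hb x hx y hy)

lemma exists_norm_laplaceKernelDeriv_le :
    ∃ C : ℝ, 0 < C ∧ ∀ x ∈ orthant d, ∀ y ∈ orthant d, x ≠ y →
      ‖laplaceKernelDeriv α ε φ x y‖ ≤
        C * (1 / ‖x - y‖ * (1 / (weightMeasure α).real (orthantBall x ‖y - x‖))) := by
  obtain ⟨C, hC, hb⟩ := exists_norm_heatIntegrandDeriv_le (fun i => (ε i).val) hα hφM
  have hV := unitBallVolume_pos d
  refine ⟨2 * C * unitBallVolume d, by positivity, fun x hx y hy hxy => ?_⟩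
  refine (norm_integral_le_of_le_shiftedWeight_mul_timeMajorant hα (by positivity) hx hxy
    (hb x hx y hy hxy)).trans_eq ?_
  ring

lemma exists_gradNorm_laplaceKernel_le (hφ : Measurable φ) :
    ∃ C : ℝ, 0 < C ∧ ∀ x ∈ orthant d, ∀ y ∈ orthant d, x ≠ y →
      gradNorm (laplaceKernel α ε φ) x y ≤
        C * (1 / ‖x - y‖ * (1 / (weightMeasure α).real (orthantBall x ‖y - x‖))) := by
  obtain ⟨C, hC, hb⟩ := exists_norm_laplaceKernelDeriv_le hα ε hφM
  refine ⟨(√(2 * d) + 1) * C, by positivity, fun x hx y hy hxy => ?_⟩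
  have hderiv := hasFDerivAt_laplaceKernel hα ε hφ hφM hx hy hxy
  rw [mul_assoc]
  calc gradNorm (laplaceKernel α ε φ) x y ≤ √(2 * d) * ‖laplaceKernelDeriv α ε φ x y‖ :=
        hderiv.fderiv ▸ gradNorm_le _ x y
    _ ≤ (√(2 * d) + 1) * ‖laplaceKernelDeriv α ε φ x y‖ := by gcongr; linarith
    _ ≤ _ := by gcongr _ * ?_; exact hb x hx y hy hxy

end Bounds

lemma kernel_eq_laplaceKernel (α : Fin d → ℝ) (ε : Fin d → Fin 2) (γ : ℝ) :
    kernel α ε γ = laplaceKernel α ε fun t =>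
      1 / Complex.Gamma (Complex.I * γ) * (t : ℂ) ^ (Complex.I * γ - 1) := by
  funext x y
  rw [kernel, laplaceKernel, ← integral_const_mul]
  simp only [kernelIntegrand, mul_left_comm]

lemma norm_const_mul_cpow_I_mul_sub_one_le (c : ℂ) (γ t : ℝ) (ht : 0 < t) :
    ‖c * (t : ℂ) ^ (Complex.I * γ - 1)‖ ≤ ‖c‖ / t := by
  rw [norm_mul, Complex.norm_cpow_eq_rpow_re_of_pos ht]
  simp [rpow_neg_one, div_eq_mul_inv]

end

end DunklHermite

theorem theorem3p4_general {d : ℕ} (α : Fin d → ℝ) (hα : ∀ i, -(1 / 2 : ℝ) ≤ α i)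
    (ε : Fin d → Fin 2) {φ : ℝ → ℂ} (hφ : Measurable φ) {M : ℝ}
    (hφM : ∀ t, 0 < t → ‖φ t‖ ≤ M / t) :
    (∀ x ∈ DunklHermite.orthant d, ∀ y ∈ DunklHermite.orthant d, x ≠ y →
      MeasureTheory.IntegrableOn (fun t => DunklHermite.heatKernel α ε t x y * φ t)
        (Set.Ioi (0 : ℝ))) ∧
    (∃ C : ℝ, 0 < C ∧
      ∀ x ∈ DunklHermite.orthant d, ∀ y ∈ DunklHermite.orthant d, x ≠ y →
        ‖DunklHermite.laplaceKernel α ε φ x y‖ ≤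
          C * (1 / (DunklHermite.weightMeasure α).real (DunklHermite.orthantBall x ‖y - x‖))) ∧
    (∃ C : ℝ, 0 < C ∧
      ∀ x ∈ DunklHermite.orthant d, ∀ y ∈ DunklHermite.orthant d, x ≠ y →
        DifferentiableAt ℝ (Function.uncurry (DunklHermite.laplaceKernel α ε φ)) (x, y) ∧
        DunklHermite.gradNorm (DunklHermite.laplaceKernel α ε φ) x y ≤
          C * (1 / ‖x - y‖ *
            (1 / (DunklHermite.weightMeasure α).real
              (DunklHermite.orthantBall x ‖y - x‖)))) := by
  refine ⟨fun x hx y hy hxy => ?_, DunklHermite.exists_norm_laplaceKernel_le hα ε hφM, ?_⟩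
  · exact (DunklHermite.integrableOn_heatIntegrand _ hφ hα hφM hx hy hxy).congr_fun
      (fun t ht => (DunklHermite.heatKernel_mul_eq_heatIntegrand α ε φ ht hx hy).symm)
      measurableSet_Ioi
  · obtain ⟨C, hC, hgrad⟩ := DunklHermite.exists_gradNorm_laplaceKernel_le hα ε hφM hφ
    exact ⟨C, hC, fun x hx y hy hxy =>
      ⟨(DunklHermite.hasFDerivAt_laplaceKernel hα ε hφ hφM hx hy hxy).differentiableAt,
        hgrad x hx y hy hxy⟩⟩

theorem theorem3p4 {d : ℕ} (α : Fin d → ℝ) (hα : ∀ i, -(1 / 2 : ℝ) ≤ α i)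
    (ε : Fin d → Fin 2) (γ : ℝ) (hγ : γ ≠ 0) :
    (∀ x ∈ DunklHermite.orthant d, ∀ y ∈ DunklHermite.orthant d, x ≠ y →
      MeasureTheory.IntegrableOn (DunklHermite.kernelIntegrand α ε γ x y) (Set.Ioi (0 : ℝ))) ∧
    (∃ C : ℝ, 0 < C ∧
      ∀ x ∈ DunklHermite.orthant d, ∀ y ∈ DunklHermite.orthant d, x ≠ y →
        ‖DunklHermite.kernel α ε γ x y‖ ≤
          C * (1 / (DunklHermite.weightMeasure α).real (DunklHermite.orthantBall x ‖y - x‖))) ∧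
    (∃ C : ℝ, 0 < C ∧
      ∀ x ∈ DunklHermite.orthant d, ∀ y ∈ DunklHermite.orthant d, x ≠ y →
        DifferentiableAt ℝ (Function.uncurry (DunklHermite.kernel α ε γ)) (x, y) ∧
        DunklHermite.gradNorm (DunklHermite.kernel α ε γ) x y ≤
          C * (1 / ‖x - y‖ *
            (1 / (DunklHermite.weightMeasure α).real
              (DunklHermite.orthantBall x ‖y - x‖)))) := by
  have hφ (c : ℂ) := theorem3p4_general α hα ε (by fun_prop)
    (DunklHermite.norm_const_mul_cpow_I_mul_sub_one_le c γ)
  exact ⟨by simpa only [one_mul] using! (hφ 1).1,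
    DunklHermite.kernel_eq_laplaceKernel α ε γ ▸ (hφ _).2⟩
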